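/- Definitions. All Hilbert spaces are finite-dimensional and complex. A state on $H$ is a positive operator of trace $1$; a channel $H\to K$ is a completely positive trace-preserving linear map $B(H)\to B(K)$. An elementary D-CTC box $(C,\Phi)\colon H\to K$ consists of a nonzero Hilbert space $C$ and a channel $\Phi\colon H\otimes C\to K\otimes C$. Given a state $\rho$ on $E\otimes H$, a state $\tau$ on $C$ is fixed if $\operatorname{tr}_{E\otimes K}\big[(\mathrm{id}_E\otimes\Phi)(\rho\otimes\tau)\big]=\tau$; let $\tau$ be the fixed state of maximal von Neumann entropy. The box sends $\rho$ to the state $\operatorname{tr}_C\big[(\mathrm{id}_E\otimes\Phi)(\rho\otimes\tau)\big]$ on $E\otimes K$. A finite (possibly empty) sequence of boxes with matching endpoints acts on states of $E\otimes H$ by successive application of its boxes. The category $\mathbf{DMix}$ has the finite-dimensional Hilbert spaces as objects. A morphism $H\to K$ is a finite sequence of boxes from $H$ to $K$, where two sequences are identified if and only if they act in the same way on all states of $E\otimes H$, for all $E$. Composition is concatenation and identities are the empty sequences. A channel $\Psi\colon H\to K$ is regarded as the morphism given by the box $(\mathbb C,\Psi\otimes\mathrm{id}_{\mathbb C})$.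 For a box $b=(C,\Phi)\colon H\to K$ and a Hilbert space $L$, let $L\otimes b\colon L\otimes H\to L\otimes K$ and $b\otimes L\colon H\otimes L\to K\otimes L$ be the boxes with the same $C$, in which $\Phi$ acts on $H\otimes C$ and the identity acts on $L$; extend this to sequences box by box. The tensor product of sequences $f\colon H\to K$ and $g\colon H'\to K'$ is the sequence $f\otimes g\colon H\otimes H'\to K\otimes K'$ consisting of $f\otimes H'$ followed by $K\otimes g$. Theorem. For every box and every state $\rho$ on $E\otimes H$ there is exactly one fixed state of maximal entropy, and every sequence of boxes sends every state on $E\otimes H$ to exactly one state on $E\otimes K$. The tensor product of sequences is well defined on morphisms of $\mathbf{DMix}$, and $\mathbf{DMix}$ is a strict symmetric monoidal category with this tensor product, with unit $\mathbb C$ and with the symmetries given by the swap channels of quantum theory. Explicitly: (a) with the tensor product of Hilbert spaces on objects, the above tensor product on morphisms, and the associators, unitors and symmetries given by conjugation with the canonical unitaries $(H\otimes K)\otimes L\cong H\otimes(K\otimes L)$, $\mathbb C\otimes H\cong H\cong H\otimes\mathbb C$ and $H\otimes K\cong K\otimes H$, the category $\mathbf{DMix}$ is symmetric monoidal; (b)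 if objects are written as unbracketed tensor products, i.e. if the objects are the finite lists $[H_1,\dots,H_n]$ of Hilbert spaces, the morphisms are those of $\mathbf{DMix}$ between the spaces $H_1\otimes(H_2\otimes\cdots(H_n\otimes\mathbb C))$, the tensor product of objects is concatenation of lists, and the tensor product of morphisms and the symmetries are transported along the canonical unitaries, then one obtains a symmetric monoidal category whose associators and unitors are identities. -/

import Mathlib

open CategoryTheory
open scoped TensorProduct

noncomputable section

/-! ## Finite-dimensional Hilbert spaces -/

/-- A finite-dimensional complex Hilbert space. -/
structure FdHilb : Type 1 where
  carrier : Type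
  [normed : NormedAddCommGroup carrier]
  [innerProd : InnerProductSpace ℂ carrier]
  [finDim : FiniteDimensional ℂ carrier]

namespace FdHilb

instance : CoeSort FdHilb Type := ⟨FdHilb.carrier⟩

attribute [instance] FdHilb.normed FdHilb.innerProd FdHilb.finDim

/-- The Hilbert space tensor product. -/
def tensor (H K : FdHilb) : FdHilb := ⟨H ⊗[ℂ] K⟩

/-- The one-dimensional Hilbert space. -/
def unit : FdHilb := ⟨ℂ⟩

infixr:70 " ⊠ " => FdHilb.tensor

/-- Operators on a finite-dimensional Hilbert space. -/
abbrev Op (H : FdHilb) : Type := H →ₗ[ℂ] H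

/-- Unitary maps. -/
abbrev Unitary (H K : FdHilb) : Type := H ≃ₗᵢ[ℂ] K

def assocU (H K L : FdHilb) : Unitary ((H ⊠ K) ⊠ L) (H ⊠ (K ⊠ L)) :=
  TensorProduct.assocIsometry ℂ H K L

def lidU (H : FdHilb) : Unitary (unit ⊠ H) H := TensorProduct.lidIsometry ℂ H

def ridU (H : FdHilb) : Unitary (H ⊠ unit) H := TensorProduct.ridIsometry ℂ H

/-- The swap `x ⊗ y ↦ y ⊗ x`. -/
def swapU (H K : FdHilb) : Unitary (H ⊠ K) (K ⊠ H) := TensorProduct.commIsometry ℂ H K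

/-- The tensor product of two unitaries. -/
def tensorU {H K H' K' : FdHilb} (u : Unitary H K) (v : Unitary H' K') :
    Unitary (H ⊠ H') (K ⊠ K') :=
  TensorProduct.congrIsometry u v

/-- Conjugation `T ↦ u T u⁻¹` by a unitary. -/
def conjU {H K : FdHilb} (u : Unitary H K) : Op H ≃ₗ[ℂ] Op K := u.toLinearEquiv.conj

/-- The identification of `B(H) ⊗ B(K)` with `B(H ⊗ K)`. -/
def opEquiv (H K : FdHilb) : Op H ⊗[ℂ] Op K ≃ₗ[ℂ] Op (H ⊠ K) :=
  homTensorHomEquiv ℂ H K H K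

/-- The operator `A ⊗ B` on `H ⊗ K`. -/
def opTensor {H K : FdHilb} (A : Op H) (B : Op K) : Op (H ⊠ K) := TensorProduct.map A B

/-- The partial trace over the right factor, `A ⊗ B ↦ tr(B) A`. -/
def ptraceRight (H K : FdHilb) : Op (H ⊠ K) →ₗ[ℂ] Op H :=
  (TensorProduct.rid ℂ (Op H)).toLinearMap ∘ₗ
    (LinearMap.trace ℂ K).lTensor (Op H) ∘ₗ (opEquiv H K).symm.toLinearMap

/-- The partial trace over the left factor, `A ⊗ B ↦ tr(A) B`. -/
def ptraceLeft (H K : FdHilb) : Op (H ⊠ K) →ₗ[ℂ] Op K :=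
  (TensorProduct.lid ℂ (Op K)).toLinearMap ∘ₗ
    (LinearMap.trace ℂ H).rTensor (Op K) ∘ₗ (opEquiv H K).symm.toLinearMap

/-- The map `id_E ⊗ Φ` on operators, `A ⊗ B ↦ A ⊗ Φ(B)`. -/
def ampl (E : FdHilb) {H K : FdHilb} (Φ : Op H →ₗ[ℂ] Op K) : Op (E ⊠ H) →ₗ[ℂ] Op (E ⊠ K) :=
  (opEquiv E K).toLinearMap ∘ₗ Φ.lTensor (Op E) ∘ₗ (opEquiv E H).symm.toLinearMap

end FdHilb

open FdHilb

/-! ## States and channels -/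

/-- A normalized quantum state: a positive operator of trace one. -/
structure QState (H : FdHilb) where
  op : Op H
  pos : op.IsPositive
  trace_one : LinearMap.trace ℂ H op = 1

/-- The von Neumann entropy `-tr(τ log τ)`. -/
def QState.entropy {H : FdHilb} (τ : QState H) : ℝ :=
  ∑ i : Fin (Module.finrank ℂ H), Real.negMulLog (τ.pos.isSymmetric.eigenvalues rfl i)

/-- A CPTP map. Complete positivity: `id_E ⊗ Φ` preserves positivity for every `E`. -/
structure Channel (H K : FdHilb) where
  map : Op H →ₗ[ℂ] Op K
  completely_positive : ∀ (E : FdHilb) (T : Op (E ⊠ H)), T.IsPositive → (ampl E map T).IsPositive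
  trace_preserving : ∀ T : Op H, LinearMap.trace ℂ K (map T) = LinearMap.trace ℂ H T

/-! Basic facts on operators on tensor products. -/

namespace FdHilb

lemma opEquiv_tmul {H K : FdHilb} (A : Op H) (B : Op K) :
    opEquiv H K (A ⊗ₜ B) = opTensor A B := by
  unfold opEquiv opTensor
  exact homTensorHomEquiv_apply ..

lemma opEquiv_symm_opTensor {H K : FdHilb} (A : Op H) (B : Op K) :
    (opEquiv H K).symm (opTensor A B) = A ⊗ₜ B := by
  rw [← opEquiv_tmul, LinearEquiv.symm_apply_apply]

/-- Linear maps out of `B(H ⊗ K)` are determined by their values on the operators `A ⊗ B`. -/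
lemma op_ext {H K : FdHilb} {M : Type} [AddCommMonoid M] [Module ℂ M]
    {f g : Op (H ⊠ K) →ₗ[ℂ] M} (h : ∀ A B, f (opTensor A B) = g (opTensor A B)) : f = g := by
  have : f ∘ₗ (opEquiv H K).toLinearMap = g ∘ₗ (opEquiv H K).toLinearMap := by
    apply TensorProduct.ext'
    intro A B
    simpa [opEquiv_tmul] using h A B
  ext1 T
  have h2 := LinearMap.congr_fun this ((opEquiv H K).symm T)
  simpa using h2

lemma op_ext_tripleRight {H K L : FdHilb} {M : Type} [AddCommMonoid M] [Module ℂ M]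
    {f g : Op (H ⊠ (K ⊠ L)) →ₗ[ℂ] M}
    (h : ∀ A B C, f (opTensor A (opTensor B C)) = g (opTensor A (opTensor B C))) : f = g := by
  apply op_ext
  intro A T
  have : f ∘ₗ (opEquiv H (K ⊠ L)).toLinearMap ∘ₗ TensorProduct.mk ℂ _ _ A =
      g ∘ₗ (opEquiv H (K ⊠ L)).toLinearMap ∘ₗ TensorProduct.mk ℂ _ _ A := by
    apply op_ext
    intro B C
    simpa [opEquiv_tmul] using h A B C
  simpa [opEquiv_tmul] using LinearMap.congr_fun this T

lemma ampl_opTensor (E : FdHilb) {H K : FdHilb} (Φ : Op H →ₗ[ℂ] Op K) (A : Op E) (B : Op H) :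
    ampl E Φ (opTensor A B) = opTensor A (Φ B) := by
  simp [ampl, opEquiv_symm_opTensor, opEquiv_tmul]

lemma ptraceRight_opTensor {H K : FdHilb} (A : Op H) (B : Op K) :
    ptraceRight H K (opTensor A B) = LinearMap.trace ℂ K B • A := by
  simp [ptraceRight, opEquiv_symm_opTensor]

lemma ptraceLeft_opTensor {H K : FdHilb} (A : Op H) (B : Op K) :
    ptraceLeft H K (opTensor A B) = LinearMap.trace ℂ H A • B := by
  simp [ptraceLeft, opEquiv_symm_opTensor]

lemma trace_opTensor {H K : FdHilb} (A : Op H) (B : Op K) :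
    LinearMap.trace ℂ (H ⊠ K : FdHilb) (opTensor A B) =
      LinearMap.trace ℂ H A * LinearMap.trace ℂ K B :=
  LinearMap.trace_tensorProduct' A B

lemma trace_conjU {H K : FdHilb} (u : Unitary H K) (T : Op H) :
    LinearMap.trace ℂ K (conjU u T) = LinearMap.trace ℂ H T :=
  LinearMap.trace_conj' T u.toLinearEquiv

lemma conjU_isPositive {H K : FdHilb} (u : Unitary H K) (T : Op H) (hT : T.IsPositive) :
    (conjU u T).IsPositive :=
  (LinearMap.isPositive_linearIsometryEquiv_conj_iff u).2 hT

lemma conjU_tensorU {H K H' K' : FdHilb} (u : Unitary H K) (v : Unitary H' K')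
    (A : Op H) (B : Op H') :
    conjU (tensorU u v) (opTensor A B) = opTensor (conjU u A) (conjU v B) := by
  apply TensorProduct.ext'
  intro x y
  change TensorProduct.congr _ _ (TensorProduct.map A B ((TensorProduct.congr _ _).symm (x ⊗ₜ y))) = _
  simp [opTensor, conjU, LinearEquiv.conj_apply]
  rfl

lemma conjU_assocU {H K L : FdHilb} (A : Op H) (B : Op K) (C : Op L) :
    conjU (assocU H K L) (opTensor (opTensor A B) C) = opTensor A (opTensor B C) := by
  apply TensorProduct.ext_threefold'
  intro x y z
  rfl

lemma conjU_assocU_symm {H K L : FdHilb} (A : Op H) (B : Op K) (C : Op L) :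
    conjU (assocU H K L).symm (opTensor A (opTensor B C)) = opTensor (opTensor A B) C := by
  apply TensorProduct.ext_threefold
  intro x y z
  rfl

lemma conjU_ridU {H : FdHilb} (A : Op H) :
    conjU (ridU H) (opTensor A (1 : Op unit)) = A := by
  ext x
  change TensorProduct.rid ℂ H (TensorProduct.map A 1 (x ⊗ₜ (1 : ℂ))) = A x
  rw [TensorProduct.map_tmul]
  simp

lemma conjU_symm_conjU {H K : FdHilb} (u : Unitary H K) (T : Op H) :
    conjU u.symm (conjU u T) = T := by
  ext x; simp [conjU, LinearEquiv.conj_apply]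

lemma conjU_conjU_symm {H K : FdHilb} (u : Unitary H K) (T : Op K) :
    conjU u (conjU u.symm T) = T := by
  ext x; simp [conjU, LinearEquiv.conj_apply]

lemma conjU_ridU_symm {H : FdHilb} (A : Op H) :
    conjU (ridU H).symm A = opTensor A (1 : Op unit) := by
  rw [← conjU_symm_conjU (ridU H) (opTensor A 1), conjU_ridU]

lemma ampl_comp (E : FdHilb) {H K L : FdHilb} (Ψ : Op K →ₗ[ℂ] Op L) (Φ : Op H →ₗ[ℂ] Op K) :
    ampl E (Ψ ∘ₗ Φ) = ampl E Ψ ∘ₗ ampl E Φ := by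
  apply op_ext
  intro A B
  simp [ampl_opTensor]

lemma ampl_conjU (E : FdHilb) {H K : FdHilb} (u : Unitary H K) :
    ampl E (conjU u).toLinearMap =
      (conjU (tensorU (LinearIsometryEquiv.refl ℂ E) u)).toLinearMap := by
  apply op_ext
  intro A B
  rw [ampl_opTensor, LinearEquiv.coe_coe, LinearEquiv.coe_coe, conjU_tensorU]
  congr 1

lemma ampl_ampl (E L : FdHilb) {H K : FdHilb} (Φ : Op H →ₗ[ℂ] Op K) (T : Op (E ⊠ (L ⊠ H))) :
    ampl E (ampl L Φ) T =
      conjU (assocU E L K) (ampl (E ⊠ L) Φ (conjU (assocU E L H).symm T)) := by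
  have : ampl E (ampl L Φ) = (conjU (assocU E L K)).toLinearMap ∘ₗ ampl (E ⊠ L) Φ ∘ₗ
      (conjU (assocU E L H).symm).toLinearMap := by
    apply op_ext_tripleRight
    intro A B C
    simp [ampl_opTensor, conjU_assocU, conjU_assocU_symm]
  exact LinearMap.congr_fun this T

lemma trace_ampl (E : FdHilb) {H K : FdHilb} (Φ : Op H →ₗ[ℂ] Op K)
    (h : ∀ T, LinearMap.trace ℂ K (Φ T) = LinearMap.trace ℂ H T) (T : Op (E ⊠ H)) :
    LinearMap.trace ℂ (E ⊠ K : FdHilb) (ampl E Φ T) = LinearMap.trace ℂ (E ⊠ H : FdHilb) T := by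
  have : LinearMap.trace ℂ (E ⊠ K : FdHilb) ∘ₗ ampl E Φ = LinearMap.trace ℂ (E ⊠ H : FdHilb) := by
    apply op_ext
    intro A B
    simp [ampl_opTensor, trace_opTensor, h]
  exact LinearMap.congr_fun this T

end FdHilb

/-! ## Operations on channels -/

namespace Channel

/-- Conjugation by a unitary. -/
def ofUnitary {H K : FdHilb} (u : Unitary H K) : Channel H K where
  map := (conjU u).toLinearMap
  completely_positive E T hT := by
    rw [ampl_conjU]
    exact conjU_isPositive _ T hT
  trace_preserving := trace_conjU u

/-- Sequential composition, `Φ` first. -/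
def comp {H K L : FdHilb} (Φ : Channel H K) (Ψ : Channel K L) : Channel H L where
  map := Ψ.map ∘ₗ Φ.map
  completely_positive E T hT := by
    rw [ampl_comp]
    exact Ψ.completely_positive E _ (Φ.completely_positive E T hT)
  trace_preserving T := by
    rw [LinearMap.comp_apply, Ψ.trace_preserving, Φ.trace_preserving]

/-- The channel `id_L ⊗ Φ`. -/
def lTensor (L : FdHilb) {H K : FdHilb} (Φ : Channel H K) : Channel (L ⊠ H) (L ⊠ K) where
  map := ampl L Φ.map
  completely_positive E T hT := by
    rw [ampl_ampl]
    exact conjU_isPositive _ _ (Φ.completely_positive _ _ (conjU_isPositive _ T hT))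
  trace_preserving := trace_ampl L Φ.map Φ.trace_preserving

end Channel

/-! ## Elementary morphisms -/

/-- An elementary D-CTC box `H → K`: a (nonzero) system `ctc` living on the closed timelike curve
and a channel `H ⊗ ctc → K ⊗ ctc`. -/
structure Box (H K : FdHilb) : Type 1 where
  ctc : FdHilb
  [nontrivial : Nontrivial ctc]
  chan : Channel (H ⊠ ctc) (K ⊠ ctc)

namespace Box

/-- The operator `(id_E ⊗ Φ)(ρ ⊗ τ)` on `(E ⊗ K) ⊗ C`, for `ρ` on `E ⊗ H` and `τ` on `C`. -/
def joint {H K : FdHilb} (b : Box H K) {E : FdHilb} (ρ : Op (E ⊠ H)) (τ : Op b.ctc) :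
    Op ((E ⊠ K) ⊠ b.ctc) :=
  conjU (assocU E K b.ctc).symm
    (ampl E b.chan.map (conjU (assocU E H b.ctc) (opTensor ρ τ)))

/-- The fixed-point equation: `τ` is unchanged by the interaction, when all the other outputs are
discarded. -/
def IsFixed {H K : FdHilb} (b : Box H K) {E : FdHilb} (ρ : QState (E ⊠ H)) (τ : QState b.ctc) :
    Prop :=
  ptraceLeft (E ⊠ K) b.ctc (b.joint ρ.op τ.op) = τ.op

/-- `τ` is a fixed point of maximal entropy. -/
def IsDeutschState {H K : FdHilb} (b : Box H K) {E : FdHilb} (ρ : QState (E ⊠ H))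
    (τ : QState b.ctc) : Prop :=
  b.IsFixed ρ τ ∧ ∀ τ' : QState b.ctc, b.IsFixed ρ τ' → τ'.entropy ≤ τ.entropy

/-- `σ` is an output of the box applied to the subsystem `H` of the state `ρ` on `E ⊗ H`: the
state of `E ⊗ K` after the interaction with a fixed point of maximal entropy. -/
def Acts {H K : FdHilb} (b : Box H K) {E : FdHilb} (ρ : QState (E ⊠ H)) (σ : QState (E ⊠ K)) :
    Prop :=
  ∃ τ : QState b.ctc, b.IsDeutschState ρ τ ∧
    σ.op = ptraceRight (E ⊠ K) b.ctc (b.joint ρ.op τ.op)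

/-- The box `L ⊗ H → L ⊗ K` in which `b` acts on `H` and nothing happens to `L`. -/
def whiskerLeft (L : FdHilb) {H K : FdHilb} (b : Box H K) : Box (L ⊠ H) (L ⊠ K) where
  ctc := b.ctc
  nontrivial := b.nontrivial
  chan := ((Channel.ofUnitary (assocU L H b.ctc)).comp (b.chan.lTensor L)).comp
    (Channel.ofUnitary (assocU L K b.ctc).symm)

/-- The box `H ⊗ L → K ⊗ L` in which `b` acts on `H` and nothing happens to `L`. -/
def whiskerRight {H K : FdHilb} (b : Box H K) (L : FdHilb) : Box (H ⊠ L) (K ⊠ L) where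
  ctc := b.ctc
  nontrivial := b.nontrivial
  chan := ((Channel.ofUnitary (tensorU (swapU H L) (LinearIsometryEquiv.refl ℂ b.ctc))).comp
    (b.whiskerLeft L).chan).comp
      (Channel.ofUnitary (tensorU (swapU L K) (LinearIsometryEquiv.refl ℂ b.ctc)))

instance : Nontrivial FdHilb.unit := inferInstanceAs (Nontrivial ℂ)

/-- A channel as a box: the system on the closed timelike curve is `ℂ`. -/
def ofChannel {H K : FdHilb} (Φ : Channel H K) : Box H K where
  ctc := FdHilb.unit
  chan := ((Channel.ofUnitary (ridU H)).comp Φ).comp (Channel.ofUnitary (ridU K).symm)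

end Box

/-! ## Sequences of elementary morphisms, and the category -/

/-- Finite sequences of elementary boxes with matching endpoints. -/
inductive Proc : FdHilb → FdHilb → Type 1
  | nil (H : FdHilb) : Proc H H
  | cons {H K L : FdHilb} (b : Box H K) (p : Proc K L) : Proc H L

namespace Proc

def single {H K : FdHilb} (b : Box H K) : Proc H K := cons b (nil K)

def append : {H K L : FdHilb} → Proc H K → Proc K L → Proc H L
  | _, _, _, nil _, q => q
  | _, _, _, cons b p, q => cons b (p.append q)

/-- `σ` is an output of the sequence `p` applied to the subsystem `H` of the state `ρ` of `E ⊗ H`. -/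
def Acts (E : FdHilb) : {H K : FdHilb} → Proc H K → QState (E ⊠ H) → QState (E ⊠ K) → Prop
  | _, _, nil _, ρ, σ => ρ = σ
  | _, _, cons b p, ρ, σ => ∃ μ, b.Acts ρ μ ∧ p.Acts E μ σ

/-- Equality of the actions on all subsystems of all states. -/
def Equiv {H K : FdHilb} (p q : Proc H K) : Prop :=
  ∀ (E : FdHilb) (ρ : QState (E ⊠ H)) (σ : QState (E ⊠ K)), p.Acts E ρ σ ↔ q.Acts E ρ σ

instance setoid (H K : FdHilb) : Setoid (Proc H K) where
  r := Equiv
  iseqv := ⟨fun _ _ _ _ => Iff.rfl, fun h E ρ σ => (h E ρ σ).symm,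
    fun h h' E ρ σ => (h E ρ σ).trans (h' E ρ σ)⟩

def whiskerLeft (L : FdHilb) : {H K : FdHilb} → Proc H K → Proc (L ⊠ H) (L ⊠ K)
  | _, _, nil H => nil (L ⊠ H)
  | _, _, cons b p => cons (b.whiskerLeft L) (p.whiskerLeft L)

def whiskerRight : {H K : FdHilb} → Proc H K → (L : FdHilb) → Proc (H ⊠ L) (K ⊠ L)
  | _, _, nil H, L => nil (H ⊠ L)
  | _, _, cons b p, L => cons (b.whiskerRight L) (p.whiskerRight L)

/-- The tensor product `p ⊗ q`: first all boxes of `p`, next to `H'`, then all boxes of `q`,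
next to `K`. -/
def tensor {H K H' K' : FdHilb} (p : Proc H K) (q : Proc H' K') : Proc (H ⊠ H') (K ⊠ K') :=
  (p.whiskerRight H').append (q.whiskerLeft K)

def ofUnitary {H K : FdHilb} (u : Unitary H K) : Proc H K :=
  single (Box.ofChannel (Channel.ofUnitary u))

lemma acts_append (E : FdHilb) {H K L : FdHilb} (p : Proc H K) (q : Proc K L)
    (ρ : QState (E ⊠ H)) (σ : QState (E ⊠ L)) :
    (p.append q).Acts E ρ σ ↔ ∃ μ, p.Acts E ρ μ ∧ q.Acts E μ σ := by
  induction p with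
  | nil => simp [append, Acts]
  | cons b p ih =>
    simp only [append, Acts, ih]
    exact ⟨fun ⟨μ, h, ν, h', h''⟩ => ⟨ν, ⟨μ, h, h'⟩, h''⟩,
      fun ⟨ν, ⟨μ, h, h'⟩, h''⟩ => ⟨μ, h, ν, h', h''⟩⟩

lemma append_nil {H K : FdHilb} (p : Proc H K) : p.append (nil K) = p := by
  induction p with
  | nil => rfl
  | cons b p ih => simp [append, ih]

lemma append_assoc {H K L M : FdHilb} (p : Proc H K) (q : Proc K L) (r : Proc L M) :
    (p.append q).append r = p.append (q.append r) := by
  induction p with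
  | nil => rfl
  | cons b p ih => simp [append, ih]

end Proc

/-- The objects of the category `DMix`: finite-dimensional Hilbert spaces. -/
abbrev DMix : Type 1 := FdHilb

/-- Morphisms are sequences of elementary boxes, up to equality of actions; composition is
concatenation of sequences. -/
instance DMix.category : Category.{1, 1} DMix where
  Hom H K := Quotient (Proc.setoid H K)
  id H := ⟦Proc.nil H⟧
  comp := Quotient.map₂ Proc.append fun p p' hp q q' hq E ρ σ => by
    rw [Proc.acts_append, Proc.acts_append]
    exact exists_congr fun μ => and_congr (hp E ρ μ) (hq E μ σ)
  id_comp f := by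
    induction f using Quotient.inductionOn
    rfl
  comp_id f := by
    induction f using Quotient.inductionOn with | _ p
    exact congrArg _ p.append_nil
  assoc f g h := by
    induction f using Quotient.inductionOn with | _ p
    induction g using Quotient.inductionOn with | _ q
    induction h using Quotient.inductionOn with | _ r
    exact congrArg _ (p.append_assoc q r)

/-! A box without closed timelike curve acts as the underlying channel. -/

namespace QState

lemma ext {H : FdHilb} {ρ σ : QState H} (h : ρ.op = σ.op) : ρ = σ := by
  cases ρ; cases σ; cases h; rfl

lemma op_unit (τ : QState FdHilb.unit) : τ.op = 1 := by
  have h := τ.trace_one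
  obtain ⟨c, hc⟩ : ∃ c : ℂ, c = τ.op (1 : ℂ) := ⟨_, rfl⟩
  have h1 : τ.op = c • (1 : Op FdHilb.unit) := by
    apply LinearMap.ext_ring
    change τ.op (1 : ℂ) = c * (1 : ℂ)
    rw [mul_one, hc]
  have h2 : LinearMap.trace ℂ FdHilb.unit (1 : Op FdHilb.unit) = 1 := by
    rw [LinearMap.trace_one]
    have : Module.finrank ℂ FdHilb.unit = 1 := Module.finrank_self ℂ
    rw [this, Nat.cast_one]
  rw [h1, map_smul, h2, smul_eq_mul, mul_one] at h
  rw [h1, h, one_smul]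

/-- The unique state of the one-dimensional system. -/
def unit : QState FdHilb.unit where
  op := 1
  pos := LinearMap.isPositive_one
  trace_one := by
    rw [LinearMap.trace_one]
    have : Module.finrank ℂ FdHilb.unit = 1 := Module.finrank_self ℂ
    rw [this, Nat.cast_one]

/-- The state `u ρ u⁻¹`. -/
def conj {H K : FdHilb} (u : Unitary H K) (ρ : QState H) : QState K where
  op := conjU u ρ.op
  pos := conjU_isPositive u _ ρ.pos
  trace_one := (trace_conjU u _).trans ρ.trace_one

end QState

lemma Box.joint_ofChannel {H K : FdHilb} (Φ : Channel H K) {E : FdHilb} (ρ : Op (E ⊠ H)) :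
    (Box.ofChannel Φ).joint ρ (1 : Op FdHilb.unit) =
      opTensor (ampl E Φ.map ρ) (1 : Op FdHilb.unit) := by
  let Ψ : Op (H ⊠ FdHilb.unit) →ₗ[ℂ] Op (K ⊠ FdHilb.unit) := (Box.ofChannel Φ).chan.map
  have hΨ : ∀ B : Op H, Ψ (opTensor B (1 : Op FdHilb.unit)) =
      opTensor (Φ.map B) (1 : Op FdHilb.unit) := by
    intro B
    change conjU (ridU K).symm (Φ.map (conjU (ridU H) (opTensor B (1 : Op FdHilb.unit)))) = _
    rw [conjU_ridU, conjU_ridU_symm]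
  have : (conjU (assocU E K FdHilb.unit).symm).toLinearMap ∘ₗ ampl E Ψ ∘ₗ
      (conjU (assocU E H FdHilb.unit)).toLinearMap ∘ₗ
      (conjU (ridU (E ⊠ H)).symm).toLinearMap =
        (conjU (ridU (E ⊠ K)).symm).toLinearMap ∘ₗ ampl E Φ.map := by
    apply op_ext
    intro A B
    simp only [LinearMap.comp_apply, LinearEquiv.coe_coe]
    rw [conjU_ridU_symm, conjU_assocU, ampl_opTensor, hΨ, conjU_assocU_symm, ampl_opTensor,
      conjU_ridU_symm]
  have h := LinearMap.congr_fun this ρ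
  simp only [LinearMap.comp_apply, LinearEquiv.coe_coe] at h
  rw [conjU_ridU_symm, conjU_ridU_symm] at h
  exact h

lemma Box.acts_ofChannel {H K : FdHilb} (Φ : Channel H K) {E : FdHilb} (ρ : QState (E ⊠ H))
    (σ : QState (E ⊠ K)) : (Box.ofChannel Φ).Acts ρ σ ↔ σ.op = ampl E Φ.map ρ.op := by
  have h1 : LinearMap.trace ℂ FdHilb.unit (1 : Op FdHilb.unit) = 1 := QState.unit.trace_one
  have key : ptraceRight (E ⊠ K) FdHilb.unit ((Box.ofChannel Φ).joint ρ.op (1 : Op FdHilb.unit)) =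
      ampl E Φ.map ρ.op := by
    rw [Box.joint_ofChannel]
    exact (ptraceRight_opTensor _ _).trans (by rw [h1, one_smul])
  constructor
  · rintro ⟨τ, -, h⟩
    have hτ : τ.op = 1 := QState.op_unit τ
    rw [hτ] at h
    exact h.trans key
  · intro h
    refine ⟨QState.unit, ⟨?_, fun τ' _ => le_of_eq ?_⟩, h.trans key.symm⟩
    · change ptraceLeft (E ⊠ K) FdHilb.unit
        ((Box.ofChannel Φ).joint ρ.op (1 : Op FdHilb.unit)) = (1 : Op FdHilb.unit)
      rw [Box.joint_ofChannel]
      refine (ptraceLeft_opTensor _ _).trans ?_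
      rw [trace_ampl E Φ.map Φ.trace_preserving, ρ.trace_one, one_smul]
    · exact congrArg QState.entropy (QState.ext (QState.op_unit τ'))

lemma Proc.ofUnitary_append_symm {H K : FdHilb} (u : Unitary H K) :
    ((Proc.ofUnitary u).append (Proc.ofUnitary u.symm)).Equiv (Proc.nil H) := by
  intro E ρ σ
  simp only [Proc.ofUnitary, Proc.single, Proc.append, Proc.Acts, Box.acts_ofChannel,
    Channel.ofUnitary, ampl_conjU, exists_eq_right, LinearEquiv.coe_coe]
  have inv : ∀ T, conjU (tensorU (LinearIsometryEquiv.refl ℂ E) u.symm)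
      (conjU (tensorU (LinearIsometryEquiv.refl ℂ E) u) T) = T := by
    intro T
    exact conjU_symm_conjU (tensorU (LinearIsometryEquiv.refl ℂ E) u) T
  constructor
  · rintro ⟨μ, h, h'⟩
    apply QState.ext
    rw [h', h, inv]
  · rintro rfl
    exact ⟨QState.conj (tensorU (LinearIsometryEquiv.refl ℂ E) u) ρ, rfl, (inv _).symm⟩

/-! ## Symmetric monoidal structures -/

namespace DMix

/-- The isomorphism inherited from quantum theory through a unitary. -/
def isoOfUnitary {H K : FdHilb} (u : Unitary H K) : (show DMix from H) ≅ (show DMix from K) where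
  hom := ⟦Proc.ofUnitary u⟧
  inv := ⟦Proc.ofUnitary u.symm⟧
  hom_inv_id := Quotient.sound (Proc.ofUnitary_append_symm u)
  inv_hom_id := Quotient.sound (Proc.ofUnitary_append_symm u.symm)

abbrev tensorObj (H K : DMix) : DMix := FdHilb.tensor H K

/-- Binary operations on morphisms with the source and target of a tensor product. -/
abbrev TensorOp : Type 1 :=
  ∀ ⦃H K H' K' : DMix⦄, (H ⟶ K) → (H' ⟶ K') → (tensorObj H H' ⟶ tensorObj K K')

/-- The data of a monoidal structure on `DMix`, with the tensor product `T` on morphisms and the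
coherence isomorphisms of Hilbert spaces. -/
abbrev monoidalData (T : TensorOp) : MonoidalCategoryStruct DMix where
  tensorObj := tensorObj
  tensorHom f g := T f g
  whiskerLeft X _ _ f := T (𝟙 X) f
  whiskerRight f X := T f (𝟙 X)
  tensorUnit := FdHilb.unit
  associator H K L := isoOfUnitary (assocU H K L)
  leftUnitor H := isoOfUnitary (lidU H)
  rightUnitor H := isoOfUnitary (ridU H)

def swap (H K : DMix) : tensorObj H K ⟶ tensorObj K H := (isoOfUnitary (swapU H K)).hom

end DMix

/-- The objects of the strict version of `DMix`: finite lists `[H₁, …, Hₙ]` of finite-dimensional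
Hilbert spaces, standing for the unbracketed tensor product `H₁ ⊗ ⋯ ⊗ Hₙ`. -/
def StrictDMix : Type 1 := List FdHilb

namespace StrictDMix

/-- The Hilbert space `H₁ ⊗ (H₂ ⊗ ⋯ (Hₙ ⊗ ℂ))`. -/
def space : List FdHilb → FdHilb
  | [] => FdHilb.unit
  | H :: l => H ⊠ space l

/-- The canonical unitary `space (l ++ m) → space l ⊗ space m`. -/
def splitU : (l m : List FdHilb) → Unitary (space (l ++ m)) (space l ⊠ space m)
  | [], m => (lidU (space m)).symm
  | H :: l, m =>
    (tensorU (LinearIsometryEquiv.refl ℂ H) (splitU l m)).trans (assocU H (space l) (space m)).symm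

abbrev toDMix (l : StrictDMix) : DMix := space l

/-- Morphisms `[H₁, …, Hₘ] ⟶ [K₁, …, Kₙ]` are the morphisms `H₁ ⊗ ⋯ ⊗ Hₘ ⟶ K₁ ⊗ ⋯ ⊗ Kₙ` of
`DMix`. -/
instance category : Category.{1, 1} StrictDMix where
  Hom l m := l.toDMix ⟶ m.toDMix
  id l := 𝟙 l.toDMix
  comp f g := CategoryStruct.comp (obj := DMix) f g
  id_comp f := Category.id_comp (obj := DMix) f
  comp_id f := Category.comp_id (obj := DMix) f
  assoc f g h := Category.assoc (obj := DMix) f g h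

/-- The tensor product of objects is concatenation of lists. -/
def tensorObj (l m : StrictDMix) : StrictDMix := List.append l m

def split (l m : StrictDMix) :
    (tensorObj l m).toDMix ≅ DMix.tensorObj l.toDMix m.toDMix :=
  DMix.isoOfUnitary (splitU l m)

/-- The tensor product of morphisms, transported along the unitaries
`space (l ++ m) ≅ space l ⊗ space m`. -/
def tensorHom (T : DMix.TensorOp) {l m l' m' : StrictDMix} (f : l ⟶ m) (g : l' ⟶ m') :
    tensorObj l l' ⟶ tensorObj m m' :=
  show (tensorObj l l').toDMix ⟶ (tensorObj m m').toDMix from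
    (split l l').hom ≫ T f g ≫ (split m m').inv

lemma tensor_assoc (l m n : StrictDMix) :
    tensorObj (tensorObj l m) n = tensorObj l (tensorObj m n) :=
  List.append_assoc (α := FdHilb) l m n

lemma unit_tensor (l : StrictDMix) : tensorObj ([] : List FdHilb) l = l := rfl

lemma tensor_unit (l : StrictDMix) : tensorObj l ([] : List FdHilb) = l :=
  List.append_nil (α := FdHilb) l

/-- The data of a strict monoidal structure: all coherence isomorphisms are identities. -/
abbrev monoidalData (T : DMix.TensorOp) : MonoidalCategoryStruct StrictDMix where
  tensorObj := tensorObj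
  tensorHom f g := tensorHom T f g
  whiskerLeft l _ _ f := tensorHom T (𝟙 l) f
  whiskerRight f l := tensorHom T f (𝟙 l)
  tensorUnit := ([] : List FdHilb)
  associator l m n := eqToIso (tensor_assoc l m n)
  leftUnitor l := eqToIso (unit_tensor l)
  rightUnitor l := eqToIso (tensor_unit l)

def swap (l m : StrictDMix) : tensorObj l m ⟶ tensorObj m l :=
  show (tensorObj l m).toDMix ⟶ (tensorObj m l).toDMix from
    (split l m).hom ≫ DMix.swap l.toDMix m.toDMix ≫ (split m l).inv

end StrictDMix

universe v u

/-- The data `s`, together with the family `b` as symmetry, satisfies the axioms of a symmetric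
monoidal category. -/
def IsSymmetricMonoidal {C : Type u} [Category.{v} C] (s : MonoidalCategoryStruct C)
    (b : ∀ X Y : C, s.tensorObj X Y ⟶ s.tensorObj Y X) : Prop :=
  ∃ M : MonoidalCategory C, M.toMonoidalCategoryStruct = s ∧
    ∃ S : SymmetricCategory C, ∀ X Y : C, HEq (S.braiding X Y).hom (b X Y)

/-- The associator and the unitors are identities. -/
def IsStrict {C : Type u} [Category.{v} C] (s : MonoidalCategoryStruct C) : Prop :=
  (∀ X Y Z : C, ∃ h : s.tensorObj (s.tensorObj X Y) Z = s.tensorObj X (s.tensorObj Y Z),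
    s.associator X Y Z = eqToIso h) ∧
  (∀ X : C, ∃ h : s.tensorObj s.tensorUnit X = X, s.leftUnitor X = eqToIso h) ∧
  (∀ X : C, ∃ h : s.tensorObj X s.tensorUnit = X, s.rightUnitor X = eqToIso h)

end

/-! The fixed-point equation for the loop state sees the input `ρ` on `E ⊗ H` only through its
marginal `s` on `H`, because nothing happens to `E` and tracing `E` out commutes with the channel
(`Channel.ctcMap_spectate`). Once the loop state `τ` is known, the box is the ordinary channel `A ↦
tr_C Φ(A ⊗ τ)` (`Channel.loop`). Hence a box, and by induction a sequence, acts on all states with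
marginal `s` as `id_E ⊗ Ψ_s` for a single channel `Ψ_s` (`Box.acts_iff`, `Proc.acts_iff`). The
dependence of `Ψ_s` on `s` is the only departure from quantum theory.

The loop state exists and is unique for the following reason. The map `τ ↦ tr_K Φ(s ⊗ τ)` is linear
and sends states to states, so it has a fixed state, namely a limit of Cesàro means in the compact
set of states. The entropy is the minimum, over orthonormal bases, of the Shannon entropy of the
diagonal; this makes it upper semicontinuous, and a maximum is attained on the compact set of fixed
states. That set is convex, and the equality case of Jensen's inequality for `-x log x` excludes two
maximisers (`QState.existsUnique_fixed_max`).

An identity between sequences follows once `Ψ_s` agrees on both sides for every `s`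
(`Proc.equiv_of_chanAt`). It thereby becomes an identity of channels, checked on product operators,
together with a comparison of the marginals that are fed in. The interchange law holds because a
channel on one factor does not alter the marginal of the other. The tensor product respects equality
of morphisms because `id_L ⊗ p` acting on `E ⊗ (L ⊗ H)` is `p` acting on `(E ⊗ L) ⊗ H`, and the
environment is arbitrary (`Proc.acts_whiskerLeft`). Pentagon, triangle and hexagons involve only
unitaries and are inherited from Hilbert spaces.

The strict version maps faithfully to `DMix`, so its structure is induced along that functor. What
remains is that the equality isomorphisms of lists match the associators and unitors under the
splitting unitaries, by induction on the list (`StrictDMix.splitU_assoc`, `StrictDMix.splitU_ridU`).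
-/

noncomputable section

open FdHilb

/-! ## Entropy of states -/

namespace QState

open scoped InnerProductSpace

variable {C : FdHilb}

/-- The diagonal entries of an operator in an orthonormal basis. -/
def diag {ι : Type*} [Fintype ι] (e : OrthonormalBasis ι ℂ C) (T : Op C) (i : ι) : ℝ :=
  (⟪e i, T (e i)⟫_ℂ).re

lemma diag_nonneg {ι : Type*} [Fintype ι] (e : OrthonormalBasis ι ℂ C) (τ : QState C) (i : ι) :
    0 ≤ diag e τ.op i :=
  τ.pos.re_inner_nonneg_right (e i)

/-- An eigenbasis of a state. -/
def eigenbasis (τ : QState C) : OrthonormalBasis (Fin (Module.finrank ℂ C)) ℂ C :=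
  τ.pos.isSymmetric.eigenvectorBasis rfl

/-- The eigenvalues of a state. -/
def eigenvalue (τ : QState C) : Fin (Module.finrank ℂ C) → ℝ :=
  τ.pos.isSymmetric.eigenvalues rfl

lemma eigenvalue_nonneg (τ : QState C) (i) : 0 ≤ τ.eigenvalue i :=
  τ.pos.nonneg_eigenvalues rfl i

lemma apply_eigenbasis (τ : QState C) (i) :
    τ.op (τ.eigenbasis i) = (τ.eigenvalue i : ℂ) • τ.eigenbasis i :=
  τ.pos.isSymmetric.apply_eigenvectorBasis rfl i

lemma diag_eigenbasis (τ : QState C) : diag τ.eigenbasis τ.op = τ.eigenvalue := by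
  ext i
  rw [diag, apply_eigenbasis, inner_smul_right, inner_self_eq_norm_sq_to_K]
  simp

lemma inner_eigenbasis_apply (τ : QState C) (x : C) (j) :
    ⟪τ.eigenbasis j, τ.op x⟫_ℂ = τ.eigenvalue j * ⟪τ.eigenbasis j, x⟫_ℂ := by
  rw [← τ.pos.isSymmetric, apply_eigenbasis, inner_smul_left]
  simp

/-- The transition probabilities between an orthonormal basis and an eigenbasis. -/
def weight {ι : Type*} [Fintype ι] (e : OrthonormalBasis ι ℂ C) (τ : QState C) (i : ι)
    (j : Fin (Module.finrank ℂ C)) : ℝ :=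
  ‖⟪e i, τ.eigenbasis j⟫_ℂ‖ ^ 2

lemma sum_weight_right {ι : Type*} [Fintype ι] (e : OrthonormalBasis ι ℂ C) (τ : QState C)
    (i : ι) : ∑ j, weight e τ i j = 1 := by
  simp [weight, OrthonormalBasis.sum_sq_norm_inner_left]

lemma sum_weight_left {ι : Type*} [Fintype ι] (e : OrthonormalBasis ι ℂ C) (τ : QState C)
    (j) : ∑ i, weight e τ i j = 1 := by
  simp [weight, OrthonormalBasis.sum_sq_norm_inner_right]

/-- Expand `e i` in the eigenbasis. The weights form a doubly stochastic matrix, so the diagonal is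
an average of the spectrum. -/
lemma diag_eq_sum_weight {ι : Type*} [Fintype ι] (e : OrthonormalBasis ι ℂ C) (τ : QState C)
    (i : ι) : diag e τ.op i = ∑ j, weight e τ i j • τ.eigenvalue j := by
  rw [diag, ← τ.eigenbasis.sum_inner_mul_inner, Complex.re_sum]
  refine Finset.sum_congr rfl fun j _ => ?_
  rw [inner_eigenbasis_apply, mul_left_comm, Complex.re_ofReal_mul, weight, smul_eq_mul, mul_comm]
  congr 1
  rw [← inner_conj_symm (τ.eigenbasis j), Complex.mul_conj, Complex.ofReal_re,
    Complex.normSq_eq_norm_sq]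

/-- Jensen's inequality for the concave function `-x log x`; row sums equal to one make it
applicable. -/
lemma sum_weight_le {ι : Type*} [Fintype ι] (e : OrthonormalBasis ι ℂ C) (τ : QState C) (i : ι) :
    ∑ j, weight e τ i j • Real.negMulLog (τ.eigenvalue j) ≤ Real.negMulLog (diag e τ.op i) := by
  rw [diag_eq_sum_weight]
  exact Real.concaveOn_negMulLog.le_map_sum (fun j _ => sq_nonneg _) (sum_weight_right e τ i)
    fun j _ => τ.eigenvalue_nonneg j

/-- Uses the column sums, so that Jensen can be applied row by row to a sum that is the entropy. -/
lemma entropy_eq_sum_weight {ι : Type*} [Fintype ι] (e : OrthonormalBasis ι ℂ C) (τ : QState C) :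
    τ.entropy = ∑ i, ∑ j, weight e τ i j • Real.negMulLog (τ.eigenvalue j) := by
  rw [Finset.sum_comm]
  simp_rw [← Finset.sum_smul, sum_weight_left, one_smul]
  rfl

/-- The entropy is at most the Shannon entropy of the diagonal entries in any basis. -/
lemma entropy_le_diag {ι : Type*} [Fintype ι] (e : OrthonormalBasis ι ℂ C) (τ : QState C) :
    τ.entropy ≤ ∑ i, Real.negMulLog (diag e τ.op i) := by
  rw [entropy_eq_sum_weight e]
  exact Finset.sum_le_sum fun i _ => sum_weight_le e τ i

/-- Equality case of Jensen: all eigenvalues with nonzero weight in row `i` coincide, so `e i` lies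
in a single eigenspace. -/
lemma apply_eq_diag_of_entropy_eq {ι : Type*} [Fintype ι] (e : OrthonormalBasis ι ℂ C)
    (τ : QState C) (h : τ.entropy = ∑ i, Real.negMulLog (diag e τ.op i)) (i : ι) :
    τ.op (e i) = (diag e τ.op i : ℂ) • e i := by
  rw [entropy_eq_sum_weight e,
    Finset.sum_eq_sum_iff_of_le fun i _ => sum_weight_le e τ i] at h
  have hi := h i (Finset.mem_univ i)
  rw [diag_eq_sum_weight, eq_comm, Real.strictConcaveOn_negMulLog.map_sum_eq_iff'
    (w := weight e τ i) (fun j _ => sq_nonneg _) (sum_weight_right e τ i)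
    fun j _ => τ.eigenvalue_nonneg j] at hi
  refine InnerProductSpace.ext_inner_left_basis τ.eigenbasis.toBasis fun j => ?_
  rw [OrthonormalBasis.coe_toBasis, inner_eigenbasis_apply, inner_smul_right]
  by_cases hj : weight e τ i j = 0
  · have : ⟪τ.eigenbasis j, e i⟫_ℂ = 0 := by
      rw [← norm_eq_zero, norm_inner_symm]
      simpa [weight] using hj
    rw [this, mul_zero, mul_zero]
  · rw [hi j (Finset.mem_univ j) hj, ← diag_eq_sum_weight]

/-- The midpoint of two states. -/
def mid (τ σ : QState C) : QState C where
  op := (2⁻¹ : ℂ) • (τ.op + σ.op)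
  pos := (τ.pos.add σ.pos).smul_of_nonneg (by
    rw [show (2⁻¹ : ℂ) = ((2⁻¹ : ℝ) : ℂ) by simp]; exact Complex.zero_le_real.2 (by norm_num))
  trace_one := by
    rw [map_smul, map_add, τ.trace_one, σ.trace_one]; norm_num

lemma diag_mid {ι : Type*} [Fintype ι] (e : OrthonormalBasis ι ℂ C) (τ σ : QState C) (i : ι) :
    diag e (mid τ σ).op i = (2⁻¹ : ℝ) • diag e τ.op i + (2⁻¹ : ℝ) • diag e σ.op i := by
  simp only [diag, mid, LinearMap.smul_apply, LinearMap.add_apply, inner_smul_right,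
    inner_add_right]
  rw [show (2⁻¹ : ℂ) = ((2⁻¹ : ℝ) : ℂ) by simp, Complex.re_ofReal_mul, Complex.add_re,
    smul_eq_mul, smul_eq_mul, mul_add]

/-- Strict concavity of the entropy, for states of equal entropy. -/
lemma eq_of_entropy_mid_le {τ σ : QState C} (h : τ.entropy = σ.entropy)
    (hm : (mid τ σ).entropy ≤ τ.entropy) : τ = σ := by
  -- In this basis the entropy of the midpoint is exactly its diagonal entropy, so all three states
  -- can be compared through their diagonals.
  set e := (mid τ σ).eigenbasis with he
  let f := Real.negMulLog
  have h0 : (mid τ σ).entropy = ∑ i, f (diag e (mid τ σ).op i) := by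
    rw [he, diag_eigenbasis]; rfl
  have hle : ∀ i ∈ Finset.univ, (2⁻¹ : ℝ) • f (diag e τ.op i) + (2⁻¹ : ℝ) • f (diag e σ.op i) ≤
      f (diag e (mid τ σ).op i) := fun i _ => by
    rw [diag_mid]
    exact Real.concaveOn_negMulLog.2 (diag_nonneg e τ i) (diag_nonneg e σ i)
      (by norm_num) (by norm_num) (by norm_num)
  have hs := Finset.sum_le_sum hle
  have hτ := entropy_le_diag e τ
  have hσ := entropy_le_diag e σ
  have hsplit : ∑ i, ((2⁻¹ : ℝ) • f (diag e τ.op i) + (2⁻¹ : ℝ) • f (diag e σ.op i)) =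
      2⁻¹ * (∑ i, f (diag e τ.op i)) + 2⁻¹ * ∑ i, f (diag e σ.op i) := by
    simp [Finset.sum_add_distrib, Finset.mul_sum]
  rw [hsplit] at hs
  -- The average of the two diagonal entropies is at most the entropy of the midpoint, hence at most
  -- the common entropy of `τ` and `σ`; each is also at least that. So both are equalities and `e`
  -- diagonalises both states.
  have eτ := apply_eq_diag_of_entropy_eq e τ (by linarith)
  have eσ := apply_eq_diag_of_entropy_eq e σ (by linarith)
  have hd : ∀ i, diag e τ.op i = diag e σ.op i := by
    intro i
    -- A differing diagonal entry would make the averaged inequality strict, contradicting the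
    -- equalities just found.
    by_contra hne
    have hlt := Real.strictConcaveOn_negMulLog.2 (diag_nonneg e τ i) (diag_nonneg e σ i) hne
      (show (0 : ℝ) < 2⁻¹ by norm_num) (show (0 : ℝ) < 2⁻¹ by norm_num) (by norm_num)
    rw [← diag_mid] at hlt
    have := Finset.sum_lt_sum hle ⟨i, Finset.mem_univ i, hlt⟩
    rw [hsplit] at this
    linarith
  apply QState.ext
  refine e.toBasis.ext fun i => ?_
  rw [OrthonormalBasis.coe_toBasis, eτ, eσ, hd]

/-! ### Fixed states of maximal entropy -/

/-- The set of states, as a subset of the normed space of operators. -/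
def stateSet (C : FdHilb) : Set (C →L[ℂ] C) :=
  {T | T.toLinearMap.IsPositive ∧ LinearMap.trace ℂ C T.toLinearMap = 1}

/-- The state given by a point of `stateSet`. -/
def ofMem {T : C →L[ℂ] C} (h : T ∈ stateSet C) : QState C := ⟨T.toLinearMap, h.1, h.2⟩

lemma toContinuousLinearMap_mem (τ : QState C) :
    LinearMap.toContinuousLinearMap τ.op ∈ stateSet C :=
  ⟨τ.pos, τ.trace_one⟩

/-- The eigenvalues are nonnegative with sum one, hence at most one. This gives the boundedness of
the set of states. -/
lemma norm_apply_le (τ : QState C) (x : C) : ‖τ.op x‖ ≤ ‖x‖ := by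
  have h1 : ∑ i, τ.eigenvalue i = 1 := by
    have h := τ.pos.isSymmetric.trace_eq_sum_eigenvalues rfl
    rw [τ.trace_one] at h
    exact Complex.ofReal_injective h.symm
  have hle : ∀ i, τ.eigenvalue i ≤ 1 := fun i =>
    h1 ▸ Finset.single_le_sum (fun j _ => τ.eigenvalue_nonneg j) (Finset.mem_univ i)
  refine le_of_sq_le_sq ?_ (norm_nonneg _)
  rw [← τ.eigenbasis.sum_sq_norm_inner_right x, ← τ.eigenbasis.sum_sq_norm_inner_right]
  refine Finset.sum_le_sum fun i _ => ?_
  rw [inner_eigenbasis_apply, norm_mul, Complex.norm_real, Real.norm_of_nonneg (τ.eigenvalue_nonneg i)]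
  exact pow_le_pow_left₀ (mul_nonneg (τ.eigenvalue_nonneg i) (norm_nonneg _))
    (mul_le_of_le_one_left (norm_nonneg _) (hle i)) 2

lemma isCompact_stateSet : IsCompact (stateSet C) := by
  have : ProperSpace (C →L[ℂ] C) := FiniteDimensional.proper ℂ _
  refine Metric.isCompact_of_isClosed_isBounded ?_ ?_
  -- Positivity is rewritten as a family of conditions on the quadratic form, each of which is
  -- visibly closed.
  · have : stateSet C = {T | ∀ x, ((⟪T x, x⟫_ℂ).re : ℂ) = ⟪T x, x⟫_ℂ ∧ 0 ≤ (⟪T x, x⟫_ℂ).re} ∩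
        {T | (LinearMap.trace ℂ C ∘ₗ (ContinuousLinearMap.coeLM ℂ)) T = 1} := by
      ext T
      exact and_congr_left' (LinearMap.isPositive_iff_complex _)
    rw [this]
    refine IsClosed.inter ?_ ?_
    · rw [Set.ofPred_forall]
      refine isClosed_iInter fun x => ?_
      have hc : Continuous fun T : C →L[ℂ] C => ⟪T x, x⟫_ℂ := by fun_prop
      have hr := Complex.continuous_re.comp hc
      exact (isClosed_eq (Complex.continuous_ofReal.comp hr) hc).inter
        (isClosed_le continuous_const hr)
    · exact isClosed_eq (LinearMap.continuous_of_finiteDimensional _) continuous_const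
  · refine (Metric.isBounded_closedBall (x := 0) (r := 1)).subset fun T hT => ?_
    rw [mem_closedBall_zero_iff]
    exact T.opNorm_le_bound zero_le_one fun x => by
      rw [one_mul]; exact norm_apply_le (ofMem hT) x

/-- The maximally mixed state. -/
def maxMixed (C : FdHilb) [Nontrivial C] : QState C where
  op := ((Module.finrank ℂ C : ℝ)⁻¹ : ℂ) • 1
  pos := LinearMap.isPositive_one.smul_of_nonneg (by
    rw [← Complex.ofReal_inv]; exact Complex.zero_le_real.2 (by positivity))
  trace_one := by
    rw [map_smul, LinearMap.trace_one, smul_eq_mul, Complex.ofReal_natCast]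
    exact inv_mul_cancel₀ (Nat.cast_ne_zero.2 Module.finrank_pos.ne')

/-- The Cesàro mean of `n + 1` states. -/
def cesaro (s : ℕ → QState C) (n : ℕ) : QState C where
  op := ((n + 1 : ℕ) : ℂ)⁻¹ • ∑ k ∈ Finset.range (n + 1), (s k).op
  pos := by
    refine LinearMap.IsPositive.smul_of_nonneg ?_ ?_
    · refine Finset.sum_induction _ LinearMap.IsPositive (fun _ _ => LinearMap.IsPositive.add)
        LinearMap.isPositive_zero fun k _ => (s k).pos
    · rw [← Complex.ofReal_natCast, ← Complex.ofReal_inv]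
      exact Complex.zero_le_real.2 (by positivity)
  trace_one := by
    simp only [map_smul, map_sum, trace_one]
    have : (n + 1 : ℂ) ≠ 0 := Nat.cast_add_one_ne_zero n
    simp [this]

/-- A linear map which maps states to states has a fixed state. -/
lemma exists_fixed [Nontrivial C] (Φ : Op C →ₗ[ℂ] Op C)
    (hΦ : ∀ τ : QState C, ∃ σ : QState C, σ.op = Φ τ.op) : ∃ τ : QState C, Φ τ.op = τ.op := by
  choose F hF using hΦ
  let s : ℕ → QState C := fun k => F^[k] (maxMixed C)
  have hs : ∀ k, Φ (s k).op = (s (k + 1)).op := fun k => by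
    simp only [s, Function.iterate_succ_apply', hF]
  let D : Op C ≃ₗ[ℂ] (C →L[ℂ] C) := LinearMap.toContinuousLinearMap
  obtain ⟨T, hT, φ, hφ, hlim⟩ := isCompact_stateSet.tendsto_subseq
    fun n => toContinuousLinearMap_mem (cesaro s n)
  let Φ' : (C →L[ℂ] C) →ₗ[ℂ] (C →L[ℂ] C) := D.toLinearMap ∘ₗ Φ ∘ₗ D.symm.toLinearMap
  have hc : Continuous Φ' := Φ'.continuous_of_finiteDimensional
  have h1 := ((hc.tendsto T).comp hlim).sub hlim
  have h2 : Filter.Tendsto (fun n : ℕ => Φ' (D (cesaro s n).op) - D (cesaro s n).op) Filter.atTop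
      (nhds 0) := by
    -- The sum telescopes: the defect of the mean from being fixed is `(s (n + 1) - s 0) / (n + 1)`,
    -- of norm at most `2 / (n + 1)`.
    have he : ∀ n : ℕ, Φ' (D (cesaro s n).op) - D (cesaro s n).op =
        ((n + 1 : ℕ) : ℂ)⁻¹ • (D (s (n + 1)).op - D (s 0).op) := by
      intro n
      simp only [Φ', LinearMap.comp_apply, LinearEquiv.coe_coe, LinearEquiv.symm_apply_apply]
      rw [← map_sub, ← map_sub, ← map_smul]
      simp only [cesaro, map_smul, map_sum, hs, ← smul_sub]
      rw [← Finset.sum_sub_distrib, Finset.sum_range_sub (fun k => (s k).op)]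
    simp_rw [he]
    refine squeeze_zero_norm (a := fun n : ℕ => (n + 1 : ℝ)⁻¹ * 2) (fun n => ?_) ?_
    · have hn : ∀ τ : QState C, ‖D τ.op‖ ≤ 1 := fun τ =>
        (D τ.op).opNorm_le_bound zero_le_one fun x => by
          rw [one_mul]; exact norm_apply_le τ x
      rw [norm_smul, norm_inv, Complex.norm_natCast, Nat.cast_succ]
      gcongr
      exact (norm_sub_le _ _).trans (by linarith [hn (s (n + 1)), hn (s 0)])
    · simpa using (tendsto_one_div_add_atTop_nhds_zero_nat (𝕜 := ℝ)).mul_const 2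
  have h3 := tendsto_nhds_unique h1 (h2.comp hφ.tendsto_atTop)
  exact ⟨ofMem hT, D.injective (sub_eq_zero.1 h3)⟩

/-- A linear map which maps states to states has exactly one fixed state of maximal entropy. -/
lemma existsUnique_fixed_max [Nontrivial C] (Φ : Op C →ₗ[ℂ] Op C)
    (hΦ : ∀ τ : QState C, ∃ σ : QState C, σ.op = Φ τ.op) :
    ∃! τ : QState C, Φ τ.op = τ.op ∧ ∀ τ' : QState C, Φ τ'.op = τ'.op → τ'.entropy ≤ τ.entropy := by
  classical
  let D : Op C ≃ₗ[ℂ] (C →L[ℂ] C) := LinearMap.toContinuousLinearMap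
  let Φ' : (C →L[ℂ] C) →ₗ[ℂ] (C →L[ℂ] C) := D.toLinearMap ∘ₗ Φ ∘ₗ D.symm.toLinearMap
  have hc : Continuous Φ' := Φ'.continuous_of_finiteDimensional
  let S : Set (C →L[ℂ] C) := stateSet C ∩ {T | Φ' T = T}
  have hS : IsCompact S := isCompact_stateSet.inter_right (isClosed_eq hc continuous_id)
  have mem : ∀ τ : QState C, Φ τ.op = τ.op → D τ.op ∈ S := fun τ h =>
    ⟨toContinuousLinearMap_mem τ, by simp [Φ', h]⟩
  have fix : ∀ T (h : T ∈ S), Φ (ofMem h.1).op = (ofMem h.1).op := fun T h => D.injective h.2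
  obtain ⟨τ₀, h₀⟩ := exists_fixed Φ hΦ
  -- The entropy is only defined on states; the default value `0` is never met, since `g` is used
  -- only on `S`.
  let g : (C →L[ℂ] C) → ℝ := fun T => if h : T ∈ stateSet C then (ofMem h).entropy else 0
  have hg : ∀ T (h : T ∈ stateSet C), g T = (ofMem h).entropy := fun T h => dif_pos h
  have usc : UpperSemicontinuousOn g S := by
    intro T hT y hy
    rw [hg T hT.1] at hy
    -- With the basis frozen at `T`, the diagonal entropy is continuous, bounds the entropy of every
    -- state from above and agrees with it at `T`. This is upper semicontinuity at `T`.
    set e := (ofMem hT.1).eigenbasis with he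
    have hcont : Continuous fun T : C →L[ℂ] C =>
        ∑ i, Real.negMulLog ((⟪e i, T (e i)⟫_ℂ).re) := by
      refine continuous_finsetSum _ fun i _ => Real.continuous_negMulLog.comp ?_
      fun_prop
    have hT' : ∑ i, Real.negMulLog ((⟪e i, T (e i)⟫_ℂ).re) < y := by
      refine lt_of_eq_of_lt ?_ hy
      change ∑ i, Real.negMulLog (diag e (ofMem hT.1).op i) = _
      rw [he, diag_eigenbasis]; rfl
    filter_upwards [nhdsWithin_le_nhds (hcont.continuousAt.eventually_lt_const hT'),
      self_mem_nhdsWithin] with T' h1 h2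
    rw [hg T' h2.1]
    exact (entropy_le_diag e (ofMem h2.1)).trans_lt h1
  obtain ⟨T, hT, hmax⟩ := usc.exists_isMaxOn ⟨_, mem τ₀ h₀⟩ hS
  refine ⟨ofMem hT.1, ⟨fix T hT, fun τ' h' => ?_⟩, ?_⟩
  · have := hmax (mem τ' h')
    rw [Set.mem_ofPred, hg T hT.1, hg _ (mem τ' h').1] at this
    exact this
  · rintro τ' ⟨h1, h2⟩
    have hle := hmax (mem τ' h1)
    rw [Set.mem_ofPred, hg T hT.1, hg _ (mem τ' h1).1] at hle
    -- The midpoint of two maximisers is again fixed, so its entropy does not exceed the maximum.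
    refine eq_of_entropy_mid_le (le_antisymm hle (h2 _ (fix T hT))) (h2 _ ?_)
    simp only [mid, map_smul, map_add, h1, fix T hT]

end QState

/-! ## Positivity of tensor products and partial traces -/

namespace FdHilb

open scoped InnerProductSpace

/-- In product orthonormal bases this is the positivity of a Kronecker product of positive
semidefinite matrices. -/
lemma opTensor_isPositive {H K : FdHilb} {A : Op H} {B : Op K} (hA : A.IsPositive)
    (hB : B.IsPositive) : (opTensor A B).IsPositive := by
  let b := stdOrthonormalBasis ℂ H
  let c := stdOrthonormalBasis ℂ K
  have key : (TensorProduct.map A B : H ⊗[ℂ] K →ₗ[ℂ] H ⊗[ℂ] K).IsPositive := by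
    rw [← LinearMap.posSemidef_toMatrix_iff (b.tensorProduct c), OrthonormalBasis.toBasis_tensorProduct,
      TensorProduct.toMatrix_map]
    exact ((LinearMap.posSemidef_toMatrix_iff b).2 hA).kronecker
      ((LinearMap.posSemidef_toMatrix_iff c).2 hB)
  exact key

/-- The bilinear map `(A, B) ↦ A ⊗ B`. -/
def opTensorₗ (H K : FdHilb) : Op H →ₗ[ℂ] Op K →ₗ[ℂ] Op (H ⊠ K) :=
  (TensorProduct.mk ℂ (Op H) (Op K)).compr₂ (opEquiv H K).toLinearMap

lemma opTensorₗ_apply {H K : FdHilb} (A : Op H) (B : Op K) :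
    opTensorₗ H K A B = opTensor A B :=
  opEquiv_tmul A B

/-- Computing the trace in an orthonormal basis exhibits the quadratic form of a partial trace as a
sum of values of that of `T`, which makes positivity evident. -/
lemma inner_ptraceRight {H K : FdHilb} (T : Op (H ⊠ K)) (x : H) :
    ⟪x, ptraceRight H K T x⟫_ℂ = ∑ i, ⟪(show (H ⊠ K : FdHilb) from
      x ⊗ₜ[ℂ] stdOrthonormalBasis ℂ K i), T (show (H ⊠ K : FdHilb) from
      x ⊗ₜ[ℂ] stdOrthonormalBasis ℂ K i)⟫_ℂ := by
  let v (i) : (H ⊠ K : FdHilb) := x ⊗ₜ[ℂ] stdOrthonormalBasis ℂ K i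
  have : (innerₛₗ ℂ x) ∘ₗ (LinearMap.applyₗ x) ∘ₗ ptraceRight H K =
      ∑ i, (innerₛₗ ℂ (v i)) ∘ₗ (LinearMap.applyₗ (v i)) := by
    apply op_ext
    intro A B
    simp only [LinearMap.comp_apply, ptraceRight_opTensor, LinearMap.sum_apply]
    have hv : ∀ i, (innerₛₗ ℂ (v i)) ((LinearMap.applyₗ (v i)) (opTensor A B)) =
        ⟪x, A x⟫_ℂ * ⟪stdOrthonormalBasis ℂ K i, B (stdOrthonormalBasis ℂ K i)⟫_ℂ := fun i =>
      TensorProduct.inner_tmul (𝕜 := ℂ) x (A x) (stdOrthonormalBasis ℂ K i) _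
    simp_rw [hv]
    rw [← Finset.mul_sum, ← LinearMap.trace_eq_sum_inner]
    simp [mul_comm]
  simpa [LinearMap.sum_apply] using LinearMap.congr_fun this T

lemma ptraceRight_isPositive {H K : FdHilb} {T : Op (H ⊠ K)} (hT : T.IsPositive) :
    (ptraceRight H K T).IsPositive := by
  rw [LinearMap.isPositive_iff_complex]
  intro x
  have h : 0 ≤ (⟪x, ptraceRight H K T x⟫_ℂ).re ∧ (⟪x, ptraceRight H K T x⟫_ℂ).im = 0 := by
    rw [inner_ptraceRight, Complex.re_sum, Complex.im_sum]
    have hi := fun i => RCLike.nonneg_iff.1 (hT.inner_nonneg_right (show (H ⊠ K : FdHilb) from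
      x ⊗ₜ[ℂ] stdOrthonormalBasis ℂ K i))
    exact ⟨Finset.sum_nonneg fun i _ => (hi i).1, Finset.sum_eq_zero fun i _ => (hi i).2⟩
  rw [← inner_conj_symm]
  generalize ⟪x, ptraceRight H K T x⟫_ℂ = z at h
  refine ⟨Complex.ext ?_ ?_, ?_⟩
  · simp
  · simpa using h.2
  · simpa using h.1

lemma conjU_swapU {H K : FdHilb} (A : Op H) (B : Op K) :
    conjU (swapU H K) (opTensor A B) = opTensor B A := by
  apply TensorProduct.ext'
  intro x y
  rfl

lemma conjU_lidU {H : FdHilb} (A : Op H) :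
    conjU (lidU H) (opTensor (1 : Op unit) A) = A := by
  ext x
  change TensorProduct.lid ℂ H (TensorProduct.map 1 A ((1 : ℂ) ⊗ₜ x)) = A x
  rw [TensorProduct.map_tmul]
  simp

lemma ptraceLeft_eq_swap {H K : FdHilb} (T : Op (H ⊠ K)) :
    ptraceLeft H K T = ptraceRight K H (conjU (swapU H K) T) := by
  have : ptraceLeft H K = ptraceRight K H ∘ₗ (conjU (swapU H K)).toLinearMap := by
    apply op_ext
    intro A B
    simp [ptraceLeft_opTensor, ptraceRight_opTensor, conjU_swapU]
  exact LinearMap.congr_fun this T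

lemma ptraceRight_eq_swap {H K : FdHilb} (T : Op (H ⊠ K)) :
    ptraceRight H K T = ptraceLeft K H (conjU (swapU H K) T) := by
  have : ptraceRight H K = ptraceLeft K H ∘ₗ (conjU (swapU H K)).toLinearMap := by
    apply op_ext
    intro A B
    simp [ptraceLeft_opTensor, ptraceRight_opTensor, conjU_swapU]
  exact LinearMap.congr_fun this T

lemma ptraceLeft_isPositive {H K : FdHilb} {T : Op (H ⊠ K)} (hT : T.IsPositive) :
    (ptraceLeft H K T).IsPositive := by
  rw [ptraceLeft_eq_swap]
  exact ptraceRight_isPositive (conjU_isPositive _ _ hT)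

lemma trace_ptraceRight {H K : FdHilb} (T : Op (H ⊠ K)) :
    LinearMap.trace ℂ H (ptraceRight H K T) = LinearMap.trace ℂ (H ⊠ K : FdHilb) T := by
  have : LinearMap.trace ℂ H ∘ₗ ptraceRight H K = LinearMap.trace ℂ (H ⊠ K : FdHilb) := by
    apply op_ext
    intro A B
    simp [ptraceRight_opTensor, trace_opTensor, mul_comm]
  exact LinearMap.congr_fun this T

lemma trace_ptraceLeft {H K : FdHilb} (T : Op (H ⊠ K)) :
    LinearMap.trace ℂ K (ptraceLeft H K T) = LinearMap.trace ℂ (H ⊠ K : FdHilb) T := by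
  rw [ptraceLeft_eq_swap, trace_ptraceRight, trace_conjU]

lemma ptraceLeft_ampl (E : FdHilb) {H K : FdHilb} (Φ : Op H →ₗ[ℂ] Op K) (T : Op (E ⊠ H)) :
    ptraceLeft E K (ampl E Φ T) = Φ (ptraceLeft E H T) := by
  have : ptraceLeft E K ∘ₗ ampl E Φ = Φ ∘ₗ ptraceLeft E H := by
    apply op_ext
    intro A B
    simp [ptraceLeft_opTensor, ampl_opTensor]
  exact LinearMap.congr_fun this T

/-- No signalling: trace preservation is what keeps an operation on `H` invisible from `E`. -/
lemma ptraceRight_ampl (E : FdHilb) {H K : FdHilb} (Φ : Op H →ₗ[ℂ] Op K)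
    (h : ∀ T, LinearMap.trace ℂ K (Φ T) = LinearMap.trace ℂ H T) (T : Op (E ⊠ H)) :
    ptraceRight E K (ampl E Φ T) = ptraceRight E H T := by
  have : ptraceRight E K ∘ₗ ampl E Φ = ptraceRight E H := by
    apply op_ext
    intro A B
    simp [ptraceRight_opTensor, ampl_opTensor, h]
  exact LinearMap.congr_fun this T

lemma ptraceRight_assoc_symm {E K C : FdHilb} (A : Op E) (T : Op (K ⊠ C)) :
    ptraceRight (E ⊠ K) C (conjU (assocU E K C).symm (opTensor A T)) =
      opTensor A (ptraceRight K C T) := by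
  have : ptraceRight (E ⊠ K) C ∘ₗ (conjU (assocU E K C).symm).toLinearMap ∘ₗ
      opTensorₗ E (K ⊠ C) A = opTensorₗ E K A ∘ₗ ptraceRight K C := by
    apply op_ext
    intro B D
    simp only [LinearMap.comp_apply, opTensorₗ_apply, LinearEquiv.coe_coe, conjU_assocU_symm,
      ptraceRight_opTensor]
    rw [← opTensorₗ_apply, ← opTensorₗ_apply, map_smul]
  simpa [opTensorₗ_apply] using LinearMap.congr_fun this T

lemma ptraceLeft_assoc_symm {E K C : FdHilb} (A : Op E) (T : Op (K ⊠ C)) :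
    ptraceLeft (E ⊠ K) C (conjU (assocU E K C).symm (opTensor A T)) =
      LinearMap.trace ℂ E A • ptraceLeft K C T := by
  have : ptraceLeft (E ⊠ K) C ∘ₗ (conjU (assocU E K C).symm).toLinearMap ∘ₗ
      opTensorₗ E (K ⊠ C) A = LinearMap.trace ℂ E A • ptraceLeft K C := by
    apply op_ext
    intro B D
    simp only [LinearMap.comp_apply, opTensorₗ_apply, LinearEquiv.coe_coe, conjU_assocU_symm,
      ptraceLeft_opTensor, trace_opTensor, LinearMap.smul_apply, smul_smul]
  simpa [opTensorₗ_apply] using LinearMap.congr_fun this T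

lemma conjU_refl {H : FdHilb} (T : Op H) : conjU (LinearIsometryEquiv.refl ℂ H) T = T := rfl

lemma ptraceRight_conjU_tensorU {H K C : FdHilb} (u : Unitary H K) (T : Op (H ⊠ C)) :
    ptraceRight K C (conjU (tensorU u (LinearIsometryEquiv.refl ℂ C)) T) =
      conjU u (ptraceRight H C T) := by
  have : ptraceRight K C ∘ₗ (conjU (tensorU u (LinearIsometryEquiv.refl ℂ C))).toLinearMap =
      (conjU u).toLinearMap ∘ₗ ptraceRight H C := by
    apply op_ext
    intro A B
    simp [conjU_tensorU, ptraceRight_opTensor, conjU_refl]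
  exact LinearMap.congr_fun this T

lemma ptraceLeft_conjU_tensorU {H K C : FdHilb} (u : Unitary H K) (T : Op (H ⊠ C)) :
    ptraceLeft K C (conjU (tensorU u (LinearIsometryEquiv.refl ℂ C)) T) =
      ptraceLeft H C T := by
  have : ptraceLeft K C ∘ₗ (conjU (tensorU u (LinearIsometryEquiv.refl ℂ C))).toLinearMap =
      ptraceLeft H C := by
    apply op_ext
    intro A B
    simp [conjU_tensorU, ptraceLeft_opTensor, conjU_refl, trace_conjU]
  exact LinearMap.congr_fun this T

end FdHilb

/-! ## Action of channels on states -/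

namespace QState

/-- The marginal state on the right factor. -/
def margRight {H K : FdHilb} (ρ : QState (H ⊠ K)) : QState K where
  op := ptraceLeft H K ρ.op
  pos := ptraceLeft_isPositive ρ.pos
  trace_one := (trace_ptraceLeft _).trans ρ.trace_one

/-- The marginal state on the left factor. -/
def margLeft {H K : FdHilb} (ρ : QState (H ⊠ K)) : QState H where
  op := ptraceRight H K ρ.op
  pos := ptraceRight_isPositive ρ.pos
  trace_one := (trace_ptraceRight _).trans ρ.trace_one

/-- The product state. -/
def prod {H K : FdHilb} (ρ : QState H) (σ : QState K) : QState (H ⊠ K) where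
  op := opTensor ρ.op σ.op
  pos := opTensor_isPositive ρ.pos σ.pos
  trace_one := by rw [trace_opTensor, ρ.trace_one, σ.trace_one, mul_one]

lemma margRight_conj_swapU {H K : FdHilb} (ρ : QState (H ⊠ K)) :
    (ρ.conj (swapU H K)).margRight = ρ.margLeft :=
  QState.ext (ptraceRight_eq_swap _).symm

lemma margLeft_conj_swapU {H K : FdHilb} (ρ : QState (H ⊠ K)) :
    (ρ.conj (swapU H K)).margLeft = ρ.margRight :=
  QState.ext (ptraceLeft_eq_swap _).symm

end QState

namespace Channel

@[ext]
lemma ext {H K : FdHilb} {Φ Ψ : Channel H K} (h : Φ.map = Ψ.map) : Φ = Ψ := by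
  cases Φ; cases Ψ; cases h; rfl

/-- The identity channel. -/
def id (H : FdHilb) : Channel H H := ofUnitary (LinearIsometryEquiv.refl ℂ H)

lemma id_map (H : FdHilb) (T : Op H) : (id H).map T = T := rfl

lemma comp_map {H K L : FdHilb} (Φ : Channel H K) (Ψ : Channel K L) (T : Op H) :
    (Φ.comp Ψ).map T = Ψ.map (Φ.map T) := rfl

/-- Complete positivity with the one-dimensional environment. -/
lemma map_isPositive {H K : FdHilb} (Φ : Channel H K) {T : Op H} (hT : T.IsPositive) :
    (Φ.map T).IsPositive := by
  have h := Φ.completely_positive unit (opTensor 1 T)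
    (opTensor_isPositive LinearMap.isPositive_one hT)
  rw [ampl_opTensor] at h
  rw [← conjU_lidU (Φ.map T)]
  exact conjU_isPositive _ _ h

/-- The output state of a channel. -/
def out {H K : FdHilb} (Φ : Channel H K) (ρ : QState H) : QState K where
  op := Φ.map ρ.op
  pos := Φ.map_isPositive ρ.pos
  trace_one := (Φ.trace_preserving _).trans ρ.trace_one

lemma out_id {H : FdHilb} (ρ : QState H) : (id H).out ρ = ρ := rfl

lemma out_comp {H K L : FdHilb} (Φ : Channel H K) (Ψ : Channel K L) (ρ : QState H) :
    (Φ.comp Ψ).out ρ = Ψ.out (Φ.out ρ) := rfl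

lemma lTensor_map_opTensor (L : FdHilb) {H K : FdHilb} (Φ : Channel H K) (A : Op L) (B : Op H) :
    (Φ.lTensor L).map (opTensor A B) = opTensor A (Φ.map B) :=
  ampl_opTensor L Φ.map A B

lemma lTensor_comp (M : FdHilb) {H K L : FdHilb} (Φ : Channel H K) (Ψ : Channel K L) :
    (Φ.comp Ψ).lTensor M = (Φ.lTensor M).comp (Ψ.lTensor M) :=
  ext (ampl_comp M Ψ.map Φ.map)

lemma lTensor_id (L H : FdHilb) : (id H).lTensor L = id (L ⊠ H) := by
  refine ext (op_ext fun A B => ?_)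
  rw [lTensor_map_opTensor, id_map, id_map]

/-- The channel `Φ ⊗ id_L`. -/
def rTensor {H K : FdHilb} (Φ : Channel H K) (L : FdHilb) : Channel (H ⊠ L) (K ⊠ L) :=
  ((ofUnitary (swapU H L)).comp (Φ.lTensor L)).comp (ofUnitary (swapU L K))

lemma rTensor_map_opTensor {H K : FdHilb} (Φ : Channel H K) (L : FdHilb) (A : Op H) (B : Op L) :
    (Φ.rTensor L).map (opTensor A B) = opTensor (Φ.map A) B := by
  change conjU _ (ampl L Φ.map (conjU _ (opTensor A B))) = _
  rw [conjU_swapU, ampl_opTensor, conjU_swapU]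

lemma rTensor_comp (M : FdHilb) {H K L : FdHilb} (Φ : Channel H K) (Ψ : Channel K L) :
    (Φ.comp Ψ).rTensor M = (Φ.rTensor M).comp (Ψ.rTensor M) := by
  refine ext (op_ext fun A B => ?_)
  simp only [comp_map, rTensor_map_opTensor]

lemma rTensor_id (L H : FdHilb) : (id H).rTensor L = id (H ⊠ L) := by
  refine ext (op_ext fun A B => ?_)
  rw [rTensor_map_opTensor, id_map, id_map]

lemma margRight_out_lTensor (L : FdHilb) {H K : FdHilb} (Φ : Channel H K) (ρ : QState (L ⊠ H)) :
    ((Φ.lTensor L).out ρ).margRight = Φ.out ρ.margRight :=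
  QState.ext (ptraceLeft_ampl L Φ.map ρ.op)

lemma margLeft_out_lTensor (L : FdHilb) {H K : FdHilb} (Φ : Channel H K) (ρ : QState (L ⊠ H)) :
    ((Φ.lTensor L).out ρ).margLeft = ρ.margLeft :=
  QState.ext (ptraceRight_ampl L Φ.map Φ.trace_preserving ρ.op)

lemma out_rTensor {H K : FdHilb} (Φ : Channel H K) (L : FdHilb) (ρ : QState (H ⊠ L)) :
    (Φ.rTensor L).out ρ = ((Φ.lTensor L).out (ρ.conj (swapU H L))).conj (swapU L K) := rfl

lemma margLeft_out_rTensor {H K : FdHilb} (Φ : Channel H K) (L : FdHilb) (ρ : QState (H ⊠ L)) :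
    ((Φ.rTensor L).out ρ).margLeft = Φ.out ρ.margLeft := by
  rw [out_rTensor, QState.margLeft_conj_swapU, margRight_out_lTensor,
    QState.margRight_conj_swapU]

lemma margRight_out_rTensor {H K : FdHilb} (Φ : Channel H K) (L : FdHilb) (ρ : QState (H ⊠ L)) :
    ((Φ.rTensor L).out ρ).margRight = ρ.margRight := by
  rw [out_rTensor, QState.margRight_conj_swapU, margLeft_out_lTensor,
    QState.margLeft_conj_swapU]

end Channel

/-! ## Boxes as state-dependent channels -/

namespace Channel

variable {H K C : FdHilb} (Φ : Channel (H ⊠ C) (K ⊠ C))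

/-- The map `A ↦ tr_C Φ(A ⊗ τ)`. -/
def outMap (τ : Op C) : Op H →ₗ[ℂ] Op K :=
  ptraceRight K C ∘ₗ Φ.map ∘ₗ (opTensorₗ H C).flip τ

/-- The map `τ ↦ tr_K Φ(s ⊗ τ)`. -/
def ctcMap (s : Op H) : Op C →ₗ[ℂ] Op C :=
  ptraceLeft K C ∘ₗ Φ.map ∘ₗ opTensorₗ H C s

lemma outMap_apply (τ : Op C) (A : Op H) :
    Φ.outMap τ A = ptraceRight K C (Φ.map (opTensor A τ)) := by
  simp [outMap, opTensorₗ_apply]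

lemma ctcMap_apply (s : Op H) (τ : Op C) :
    Φ.ctcMap s τ = ptraceLeft K C (Φ.map (opTensor s τ)) := by
  simp [ctcMap, opTensorₗ_apply]

/-- The channel `id_L ⊗ Φ`, with the loop system kept on the right. -/
def spectate (L : FdHilb) : Channel ((L ⊠ H) ⊠ C) ((L ⊠ K) ⊠ C) :=
  ((ofUnitary (assocU L H C)).comp (Φ.lTensor L)).comp (ofUnitary (assocU L K C).symm)

lemma spectate_map_opTensor (L : FdHilb) (A : Op L) (B : Op H) (τ : Op C) :
    (Φ.spectate L).map (opTensor (opTensor A B) τ) =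
      conjU (assocU L K C).symm (opTensor A (Φ.map (opTensor B τ))) := by
  change conjU _ (ampl L Φ.map (conjU _ _)) = _
  rw [conjU_assocU, ampl_opTensor]

/-- With the loop state held fixed, a bystander `L` is merely tensored on. -/
lemma outMap_spectate (L : FdHilb) (τ : Op C) :
    (Φ.spectate L).outMap τ = ampl L (Φ.outMap τ) := by
  apply op_ext
  intro A B
  rw [outMap_apply, spectate_map_opTensor, ptraceRight_assoc_symm, ampl_opTensor, outMap_apply]

/-- The key to the whole proof: a bystander enters the fixed-point equation only through the trace
over it, so correlations between `L` and `H` are irrelevant to the loop. -/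
lemma ctcMap_spectate (L : FdHilb) (s : Op (L ⊠ H)) :
    (Φ.spectate L).ctcMap s = Φ.ctcMap (ptraceLeft L H s) := by
  ext1 τ
  have : ptraceLeft (L ⊠ K) C ∘ₗ (Φ.spectate L).map ∘ₗ (opTensorₗ (L ⊠ H) C).flip τ =
      ptraceLeft K C ∘ₗ Φ.map ∘ₗ (opTensorₗ H C).flip τ ∘ₗ ptraceLeft L H := by
    apply op_ext
    intro A B
    simp only [LinearMap.comp_apply, LinearMap.flip_apply, opTensorₗ_apply, spectate_map_opTensor,
      ptraceLeft_assoc_symm, ptraceLeft_opTensor]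
    rw [← opTensorₗ_apply, ← opTensorₗ_apply, map_smul, LinearMap.smul_apply, map_smul, map_smul]
  rw [ctcMap_apply, ctcMap_apply]
  simpa only [LinearMap.comp_apply, LinearMap.flip_apply, opTensorₗ_apply] using
    LinearMap.congr_fun this s

/-- The map on loop states is a composite of forming a product state, applying a channel and taking
a marginal, hence sends states to states. -/
lemma existsUnique_deutsch [Nontrivial C] (s : QState H) :
    ∃! τ : QState C, Φ.ctcMap s.op τ.op = τ.op ∧
      ∀ τ' : QState C, Φ.ctcMap s.op τ'.op = τ'.op → τ'.entropy ≤ τ.entropy := by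
  refine QState.existsUnique_fixed_max _ fun τ => ⟨(Φ.out (s.prod τ)).margRight, ?_⟩
  rw [ctcMap_apply]; rfl

/-! ### Closing the loop -/

variable [Nontrivial C]

/-- The fixed state of maximal entropy, for an input with marginal state `s`. -/
def deutsch (s : QState H) : QState C := (Φ.existsUnique_deutsch s).choose

lemma eq_deutsch_iff (s : QState H) (τ : QState C) : τ = Φ.deutsch s ↔
    Φ.ctcMap s.op τ.op = τ.op ∧
      ∀ τ' : QState C, Φ.ctcMap s.op τ'.op = τ'.op → τ'.entropy ≤ τ.entropy := by
  have h := (Φ.existsUnique_deutsch s).choose_spec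
  exact ⟨fun e => e ▸ h.1, h.2 τ⟩

/-- The loop state is determined by the induced map on the loop system alone; the open systems may
differ. -/
lemma deutsch_congr {H' K' : FdHilb} {Ψ : Channel (H' ⊠ C) (K' ⊠ C)} {s : QState H}
    {t : QState H'} (h : Φ.ctcMap s.op = Ψ.ctcMap t.op) : Φ.deutsch s = Ψ.deutsch t := by
  rw [eq_deutsch_iff, ← h]
  exact (Φ.eq_deutsch_iff _ _).1 rfl

lemma deutsch_spectate (L : FdHilb) (s : QState (L ⊠ H)) :
    (Φ.spectate L).deutsch s = Φ.deutsch s.margRight :=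
  deutsch_congr _ (Φ.ctcMap_spectate L s.op)

/-- The channel by which `Φ`, with its loop closed, acts on states with marginal state `s`. -/
def loop (s : QState H) : Channel H K where
  map := Φ.outMap (Φ.deutsch s).op
  completely_positive E T hT := by
    rw [← outMap_spectate, outMap_apply]
    exact ptraceRight_isPositive ((Φ.spectate E).map_isPositive
      (opTensor_isPositive hT (Φ.deutsch s).pos))
  trace_preserving T := by
    rw [outMap_apply, trace_ptraceRight, Φ.trace_preserving, trace_opTensor,
      (Φ.deutsch s).trace_one, mul_one]

lemma loop_spectate (L : FdHilb) (s : QState (L ⊠ H)) :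
    (Φ.spectate L).loop s = (Φ.loop s.margRight).lTensor L := by
  refine ext ?_
  change (Φ.spectate L).outMap _ = ampl L (Φ.outMap _)
  rw [deutsch_spectate, outMap_spectate]

lemma loop_ofUnitary {H' K' : FdHilb} (u : Unitary H' H) (v : Unitary K K') (s : QState H') :
    (((ofUnitary (tensorU u (LinearIsometryEquiv.refl ℂ C))).comp Φ).comp
      (ofUnitary (tensorU v (LinearIsometryEquiv.refl ℂ C)))).loop s =
        ((ofUnitary u).comp (Φ.loop (s.conj u))).comp (ofUnitary v) := by
  set Ψ := ((ofUnitary (tensorU u (LinearIsometryEquiv.refl ℂ C))).comp Φ).comp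
    (ofUnitary (tensorU v (LinearIsometryEquiv.refl ℂ C))) with hΨ
  have hmap : ∀ (A : Op H') (τ : Op C), Ψ.map (opTensor A τ) =
      conjU (tensorU v (LinearIsometryEquiv.refl ℂ C)) (Φ.map (opTensor (conjU u A) τ)) := by
    intro A τ
    have h := conjU_tensorU u (LinearIsometryEquiv.refl ℂ C) A τ
    rw [conjU_refl] at h
    rw [← h]; rfl
  have hd : Ψ.deutsch s = Φ.deutsch (s.conj u) := by
    refine deutsch_congr _ (LinearMap.ext fun τ => ?_)
    rw [ctcMap_apply, ctcMap_apply, hmap, ptraceLeft_conjU_tensorU]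
    rfl
  refine ext (LinearMap.ext fun T => ?_)
  change Ψ.outMap _ T = conjU v (Φ.outMap _ (conjU u T))
  rw [hd, outMap_apply, outMap_apply, hmap, ptraceRight_conjU_tensorU]

/-- The one-dimensional loop system has only one state, so nothing depends on the input. -/
lemma loop_ofChannel (Ψ : Channel H K) (s : QState H) :
    (((ofUnitary (ridU H)).comp Ψ).comp (ofUnitary (ridU K).symm)).loop s = Ψ := by
  have h1 : LinearMap.trace ℂ FdHilb.unit (1 : Op FdHilb.unit) = 1 := QState.unit.trace_one
  have h : ∀ (τ : QState FdHilb.unit) (T : Op H),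
      (((ofUnitary (ridU H)).comp Ψ).comp (ofUnitary (ridU K).symm)).outMap τ.op T = Ψ.map T := by
    intro τ T
    have hτ : τ.op = (1 : Op FdHilb.unit) := QState.op_unit τ
    rw [hτ]
    refine (outMap_apply _ _ _).trans ?_
    change ptraceRight K FdHilb.unit
      (conjU (ridU K).symm (Ψ.map (conjU (ridU H) (opTensor T (1 : Op FdHilb.unit))))) = _
    rw [conjU_ridU, conjU_ridU_symm]
    exact (ptraceRight_opTensor _ _).trans (by rw [h1, one_smul])
  exact ext (LinearMap.ext fun T => h _ T)

end Channel

namespace Box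

variable {H K : FdHilb} (b : Box H K)

instance : Nontrivial b.ctc := b.nontrivial

/-- The channel by which a box acts on states with marginal state `s`. -/
def chanAt (s : QState H) : Channel H K := b.chan.loop s

/-- The operator `joint` unfolds to `spectate E` applied to `ρ ⊗ τ`, so the environment can be
removed by `deutsch_spectate`. -/
lemma isDeutschState_iff {E : FdHilb} (ρ : QState (E ⊠ H)) (τ : QState b.ctc) :
    b.IsDeutschState ρ τ ↔ τ = b.chan.deutsch ρ.margRight := by
  have h : ∀ τ : QState b.ctc, b.IsFixed ρ τ ↔ (b.chan.spectate E).ctcMap ρ.op τ.op = τ.op := by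
    intro τ
    rw [Channel.ctcMap_apply]; rfl
  rw [← Channel.deutsch_spectate, Channel.eq_deutsch_iff]
  simp only [IsDeutschState, h]

lemma acts_iff {E : FdHilb} (ρ : QState (E ⊠ H)) (σ : QState (E ⊠ K)) :
    b.Acts ρ σ ↔ σ = ((b.chanAt ρ.margRight).lTensor E).out ρ := by
  have h : ptraceRight (E ⊠ K) b.ctc (b.joint ρ.op (b.chan.deutsch ρ.margRight).op) =
      (((b.chanAt ρ.margRight).lTensor E).out ρ).op := by
    rw [chanAt, ← Channel.loop_spectate]
    change _ = (b.chan.spectate E).outMap _ _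
    rw [Channel.outMap_apply, Channel.deutsch_spectate]; rfl
  simp only [Acts, isDeutschState_iff, exists_eq_left, h]
  exact ⟨QState.ext, congrArg QState.op⟩

lemma chanAt_whiskerLeft (L : FdHilb) (s : QState (L ⊠ H)) :
    (b.whiskerLeft L).chanAt s = (b.chanAt s.margRight).lTensor L :=
  b.chan.loop_spectate L s

lemma chanAt_whiskerRight (L : FdHilb) (s : QState (H ⊠ L)) :
    (b.whiskerRight L).chanAt s = (b.chanAt s.margLeft).rTensor L := by
  rw [Channel.rTensor, ← QState.margRight_conj_swapU, ← chanAt_whiskerLeft]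
  exact (b.chan.spectate L).loop_ofUnitary (swapU H L) (swapU L K) s

lemma chanAt_ofChannel (Φ : Channel H K) (s : QState H) : (ofChannel Φ).chanAt s = Φ :=
  Channel.loop_ofChannel Φ s

end Box

/-! ## Sequences as state-dependent channels -/

namespace Proc

/-- The channel by which a sequence acts on states with marginal state `s`. -/
def chanAt : {H K : FdHilb} → Proc H K → QState H → Channel H K
  | _, _, nil H, _ => Channel.id H
  | _, _, cons b p, s => (b.chanAt s).comp (p.chanAt ((b.chanAt s).out s))

/-- Induction along the sequence: after each box the marginal on the open system is the output of
that box on the old marginal, independently of `E`. -/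
lemma acts_iff {H K : FdHilb} (p : Proc H K) {E : FdHilb} (ρ : QState (E ⊠ H))
    (σ : QState (E ⊠ K)) : p.Acts E ρ σ ↔ σ = ((p.chanAt ρ.margRight).lTensor E).out ρ := by
  induction p with
  | nil => rw [Acts, chanAt, Channel.lTensor_id, Channel.out_id, eq_comm]
  | cons b p ih =>
    simp only [Acts, Box.acts_iff, ih, exists_eq_left]
    rw [Channel.margRight_out_lTensor, ← Channel.out_comp, ← Channel.lTensor_comp]
    rfl

/-- The tool for every coherence law below. Equality of actions constrains `chanAt s` only on inputs
with marginal `s`, which is why the congruence lemmas argue with `Acts` instead. -/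
lemma equiv_of_chanAt {H K : FdHilb} {p q : Proc H K} (h : ∀ s, p.chanAt s = q.chanAt s) :
    p.Equiv q := by
  intro E ρ σ
  rw [acts_iff, acts_iff, h]

lemma chanAt_append {H K L : FdHilb} (p : Proc H K) (q : Proc K L) (s : QState H) :
    (p.append q).chanAt s = (p.chanAt s).comp (q.chanAt ((p.chanAt s).out s)) := by
  induction p with
  | nil => rfl
  | cons b p ih =>
    simp only [append, chanAt, ih]
    rfl

lemma chanAt_ofUnitary {H K : FdHilb} (u : Unitary H K) (s : QState H) :
    (ofUnitary u).chanAt s = Channel.ofUnitary u := by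
  simp only [ofUnitary, single, chanAt, Box.chanAt_ofChannel]
  rfl

lemma chanAt_whiskerLeft (L : FdHilb) {H K : FdHilb} (p : Proc H K) (s : QState (L ⊠ H)) :
    (p.whiskerLeft L).chanAt s = (p.chanAt s.margRight).lTensor L := by
  induction p with
  | nil => exact (Channel.lTensor_id ..).symm
  | cons b p ih =>
    simp only [whiskerLeft, chanAt, Box.chanAt_whiskerLeft, ih, Channel.lTensor_comp,
      Channel.margRight_out_lTensor]

lemma chanAt_whiskerRight (L : FdHilb) {H K : FdHilb} (p : Proc H K) (s : QState (H ⊠ L)) :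
    (p.whiskerRight L).chanAt s = (p.chanAt s.margLeft).rTensor L := by
  induction p with
  | nil => exact (Channel.rTensor_id ..).symm
  | cons b p ih =>
    simp only [whiskerRight, chanAt, Box.chanAt_whiskerRight, ih, Channel.rTensor_comp,
      Channel.margLeft_out_rTensor]

end Proc

/-! ## Coherence for operators and states -/

namespace FdHilb

lemma op_ext_tripleLeft {H K L : FdHilb} {M : Type} [AddCommMonoid M] [Module ℂ M]
    {f g : Op ((H ⊠ K) ⊠ L) →ₗ[ℂ] M}
    (h : ∀ A B C, f (opTensor (opTensor A B) C) = g (opTensor (opTensor A B) C)) : f = g := by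
  have h2 : f ∘ₗ (conjU (assocU H K L).symm).toLinearMap =
      g ∘ₗ (conjU (assocU H K L).symm).toLinearMap := by
    apply op_ext_tripleRight
    intro A B C
    simpa [conjU_assocU_symm] using h A B C
  ext1 T
  have h3 := LinearMap.congr_fun h2 (conjU (assocU H K L) T)
  simpa [conjU_symm_conjU] using h3

lemma op_unit_eq_smul (A : Op unit) : A = LinearMap.trace ℂ unit A • (1 : Op unit) := by
  have h : ∃ c : ℂ, A = c • (1 : Op unit) := by
    obtain ⟨c, hc⟩ : ∃ c : ℂ, c = A (1 : ℂ) := ⟨_, rfl⟩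
    refine ⟨c, LinearMap.ext_ring ?_⟩
    change A (1 : ℂ) = c * (1 : ℂ)
    rw [mul_one, hc]
  obtain ⟨c, rfl⟩ := h
  have h1 : LinearMap.trace ℂ unit (1 : Op unit) = 1 := QState.unit.trace_one
  rw [map_smul, h1, smul_eq_mul, mul_one]

/-- Seeing the unitor as a partial trace turns its naturality into `ptraceLeft_ampl`, and identifies
the marginal with the conjugated state. -/
lemma conjU_lidU_eq {H : FdHilb} (T : Op (unit ⊠ H)) :
    conjU (lidU H) T = ptraceLeft unit H T := by
  have : (conjU (lidU H)).toLinearMap = ptraceLeft unit H := by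
    apply op_ext
    intro A B
    rw [ptraceLeft_opTensor]
    nth_rw 1 [op_unit_eq_smul A]
    rw [← opTensorₗ_apply, map_smul, LinearMap.smul_apply, opTensorₗ_apply, map_smul,
      LinearEquiv.coe_coe, conjU_lidU]
  exact LinearMap.congr_fun this T

lemma conjU_ridU_eq {H : FdHilb} (T : Op (H ⊠ unit)) :
    conjU (ridU H) T = ptraceRight H unit T := by
  have : (conjU (ridU H)).toLinearMap = ptraceRight H unit := by
    apply op_ext
    intro A B
    rw [ptraceRight_opTensor]
    nth_rw 1 [op_unit_eq_smul B]
    rw [← opTensorₗ_apply, map_smul, opTensorₗ_apply, map_smul,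
      LinearEquiv.coe_coe, conjU_ridU]
  exact LinearMap.congr_fun this T

end FdHilb

namespace QState

variable {H K L : FdHilb}

lemma conj_eq_iff (u : Unitary H K) (ρ : QState H) (σ : QState K) :
    σ.conj u.symm = ρ ↔ σ = ρ.conj u := by
  constructor
  · rintro rfl
    exact QState.ext (conjU_conjU_symm u _).symm
  · rintro rfl
    exact QState.ext (conjU_symm_conjU u _)

lemma margRight_conj_assocU_symm (ρ : QState (H ⊠ (K ⊠ L))) :
    (ρ.conj (assocU H K L).symm).margRight = ρ.margRight.margRight := by
  have : ptraceLeft (H ⊠ K) L ∘ₗ (conjU (assocU H K L).symm).toLinearMap =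
      ptraceLeft K L ∘ₗ ptraceLeft H (K ⊠ L) := by
    apply op_ext_tripleRight
    intro A B C
    simp [ptraceLeft_opTensor, conjU_assocU_symm, trace_opTensor, mul_smul]
  exact QState.ext (LinearMap.congr_fun this ρ.op)

lemma margLeft_conj_assocU (ρ : QState ((H ⊠ K) ⊠ L)) :
    (ρ.conj (assocU H K L)).margLeft = ρ.margLeft.margLeft := by
  have : ptraceRight H (K ⊠ L) ∘ₗ (conjU (assocU H K L)).toLinearMap =
      ptraceRight H K ∘ₗ ptraceRight (H ⊠ K) L := by
    apply op_ext_tripleLeft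
    intro A B C
    simp [ptraceRight_opTensor, conjU_assocU, trace_opTensor, smul_smul, mul_comm]
  exact QState.ext (LinearMap.congr_fun this ρ.op)

lemma margLeft_margRight_conj_assocU (ρ : QState ((H ⊠ K) ⊠ L)) :
    (ρ.conj (assocU H K L)).margRight.margLeft = ρ.margLeft.margRight := by
  have : ptraceRight K L ∘ₗ ptraceLeft H (K ⊠ L) ∘ₗ (conjU (assocU H K L)).toLinearMap =
      ptraceLeft H K ∘ₗ ptraceRight (H ⊠ K) L := by
    apply op_ext_tripleLeft
    intro A B C
    simp [ptraceRight_opTensor, ptraceLeft_opTensor, conjU_assocU, smul_smul, mul_comm]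
  exact QState.ext (LinearMap.congr_fun this ρ.op)

lemma margRight_margRight_conj_assocU (ρ : QState ((H ⊠ K) ⊠ L)) :
    (ρ.conj (assocU H K L)).margRight.margRight = ρ.margRight := by
  rw [← margRight_conj_assocU_symm, (conj_eq_iff _ _ _).2 rfl]

lemma margRight_eq_conj_lidU (ρ : QState (FdHilb.unit ⊠ H)) :
    ρ.margRight = ρ.conj (lidU H) :=
  QState.ext (conjU_lidU_eq ρ.op).symm

lemma margLeft_eq_conj_ridU (ρ : QState (H ⊠ FdHilb.unit)) :
    ρ.margLeft = ρ.conj (ridU H) :=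
  QState.ext (conjU_ridU_eq ρ.op).symm

end QState

namespace Channel

variable {H K L H' K' : FdHilb}

lemma ofUnitary_map (u : Unitary H K) (T : Op H) : (ofUnitary u).map T = conjU u T := rfl

lemma out_ofUnitary (u : Unitary H K) (ρ : QState H) : (ofUnitary u).out ρ = ρ.conj u := rfl

lemma out_lTensor_lTensor (Φ : Channel H K) (E L : FdHilb) (ρ : QState (E ⊠ (L ⊠ H))) :
    ((Φ.lTensor L).lTensor E).out ρ =
      ((Φ.lTensor (E ⊠ L)).out (ρ.conj (assocU E L H).symm)).conj (assocU E L K) :=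
  QState.ext (ampl_ampl E L Φ.map ρ.op)

lemma ofUnitary_trans (u : Unitary H K) (v : Unitary K L) :
    ofUnitary (u.trans v) = (ofUnitary u).comp (ofUnitary v) := rfl

lemma lTensor_ofUnitary (L : FdHilb) (u : Unitary H K) :
    (ofUnitary u).lTensor L = ofUnitary (tensorU (LinearIsometryEquiv.refl ℂ L) u) :=
  ext (ampl_conjU L u)

lemma rTensor_ofUnitary (L : FdHilb) (u : Unitary H K) :
    (ofUnitary u).rTensor L = ofUnitary (tensorU u (LinearIsometryEquiv.refl ℂ L)) := by
  refine ext (op_ext fun A B => ?_)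
  rw [rTensor_map_opTensor, ofUnitary_map, ofUnitary_map, conjU_tensorU, conjU_refl]

lemma rTensor_comp_lTensor (Φ : Channel H K) (Ψ : Channel H' K') :
    (Φ.rTensor H').comp (Ψ.lTensor K) = (Ψ.lTensor H).comp (Φ.rTensor K') := by
  refine ext (op_ext fun A B => ?_)
  simp only [comp_map, rTensor_map_opTensor, lTensor_map_opTensor]

lemma rTensor_rTensor_assoc (Φ : Channel H H') (K L : FdHilb) :
    ((Φ.rTensor K).rTensor L).comp (ofUnitary (assocU H' K L)) =
      (ofUnitary (assocU H K L)).comp (Φ.rTensor (K ⊠ L)) := by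
  refine ext (op_ext_tripleLeft fun A B C => ?_)
  simp only [comp_map, rTensor_map_opTensor, ofUnitary_map, conjU_assocU]

lemma rTensor_lTensor_assoc (Φ : Channel K K') (H L : FdHilb) :
    ((Φ.lTensor H).rTensor L).comp (ofUnitary (assocU H K' L)) =
      (ofUnitary (assocU H K L)).comp ((Φ.rTensor L).lTensor H) := by
  refine ext (op_ext_tripleLeft fun A B C => ?_)
  simp only [comp_map, rTensor_map_opTensor, lTensor_map_opTensor, ofUnitary_map, conjU_assocU]

lemma lTensor_lTensor_assoc (Φ : Channel L H') (H K : FdHilb) :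
    (Φ.lTensor (H ⊠ K)).comp (ofUnitary (assocU H K H')) =
      (ofUnitary (assocU H K L)).comp ((Φ.lTensor K).lTensor H) := by
  refine ext (op_ext_tripleLeft fun A B C => ?_)
  simp only [comp_map, lTensor_map_opTensor, ofUnitary_map, conjU_assocU]

lemma lTensor_lidU (Φ : Channel H K) :
    (Φ.lTensor unit).comp (ofUnitary (lidU K)) = (ofUnitary (lidU H)).comp Φ := by
  refine ext (LinearMap.ext fun T => ?_)
  simp only [comp_map, ofUnitary_map, conjU_lidU_eq]
  exact ptraceLeft_ampl unit Φ.map T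

lemma rTensor_ridU (Φ : Channel H K) :
    (Φ.rTensor unit).comp (ofUnitary (ridU K)) = (ofUnitary (ridU H)).comp Φ := by
  refine ext (op_ext fun A B => ?_)
  simp only [comp_map, ofUnitary_map, conjU_ridU_eq, rTensor_map_opTensor, ptraceRight_opTensor,
    map_smul]

lemma rTensor_swapU (Φ : Channel H K) (L : FdHilb) :
    (Φ.rTensor L).comp (ofUnitary (swapU K L)) = (ofUnitary (swapU H L)).comp (Φ.lTensor L) := by
  refine ext (op_ext fun A B => ?_)
  simp only [comp_map, ofUnitary_map, rTensor_map_opTensor, lTensor_map_opTensor, conjU_swapU]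

lemma lTensor_swapU (Φ : Channel H K) (L : FdHilb) :
    (Φ.lTensor L).comp (ofUnitary (swapU L K)) = (ofUnitary (swapU L H)).comp (Φ.rTensor L) := by
  refine ext (op_ext fun A B => ?_)
  simp only [comp_map, ofUnitary_map, rTensor_map_opTensor, lTensor_map_opTensor, conjU_swapU]

end Channel

/-! ## Coherence for sequences -/

namespace Proc

variable {H K L H' K' : FdHilb}

/-- The bystander `L` is absorbed into the environment by rebracketing. -/
lemma acts_whiskerLeft (p : Proc H K) (L E : FdHilb) (ρ : QState (E ⊠ (L ⊠ H)))
    (σ : QState (E ⊠ (L ⊠ K))) : (p.whiskerLeft L).Acts E ρ σ ↔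
      p.Acts (E ⊠ L) (ρ.conj (assocU E L H).symm) (σ.conj (assocU E L K).symm) := by
  rw [acts_iff, acts_iff, chanAt_whiskerLeft, Channel.out_lTensor_lTensor, QState.conj_eq_iff,
    QState.margRight_conj_assocU_symm]

/-- Equality of morphisms quantifies over all environments, in particular over `E ⊗ L`. -/
lemma whiskerLeft_congr (L : FdHilb) {p q : Proc H K} (h : p.Equiv q) :
    (p.whiskerLeft L).Equiv (q.whiskerLeft L) := by
  intro E ρ σ
  rw [acts_whiskerLeft, acts_whiskerLeft]
  exact h _ _ _

lemma append_congr {p p' : Proc H K} {q q' : Proc K L} (hp : p.Equiv p') (hq : q.Equiv q') :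
    (p.append q).Equiv (p'.append q') := fun E ρ σ => by
  rw [acts_append, acts_append]
  exact exists_congr fun μ => and_congr (hp E ρ μ) (hq E μ σ)

/-- Transfers congruence from left to right whiskering by conjugating with swaps. -/
lemma whiskerRight_equiv (p : Proc H K) (L : FdHilb) : (p.whiskerRight L).Equiv
    (((ofUnitary (swapU H L)).append (p.whiskerLeft L)).append (ofUnitary (swapU L K))) := by
  refine equiv_of_chanAt fun s => ?_
  simp only [chanAt_append, chanAt_ofUnitary, chanAt_whiskerLeft, chanAt_whiskerRight,
    Channel.out_ofUnitary, QState.margRight_conj_swapU]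
  rfl

lemma whiskerRight_congr (L : FdHilb) {p q : Proc H K} (h : p.Equiv q) :
    (p.whiskerRight L).Equiv (q.whiskerRight L) := by
  intro E ρ σ
  rw [whiskerRight_equiv p L E ρ σ, whiskerRight_equiv q L E ρ σ]
  exact append_congr (append_congr (fun _ _ _ => Iff.rfl) (whiskerLeft_congr L h))
    (fun _ _ _ => Iff.rfl) E ρ σ

lemma whiskerLeft_append (M : FdHilb) (p : Proc H K) (q : Proc K L) :
    (p.append q).whiskerLeft M = (p.whiskerLeft M).append (q.whiskerLeft M) := by
  induction p with
  | nil => rfl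
  | cons b p ih => simp only [append, whiskerLeft, ih]

lemma whiskerRight_append (M : FdHilb) (p : Proc H K) (q : Proc K L) :
    (p.append q).whiskerRight M = (p.whiskerRight M).append (q.whiskerRight M) := by
  induction p with
  | nil => rfl
  | cons b p ih => simp only [append, whiskerRight, ih]

/-- Neither operation changes the marginal on which the other depends, so the same two channels
occur in both orders, and channels on different factors commute. -/
lemma whisker_exchange (p : Proc H K) (q : Proc H' K') :
    ((p.whiskerRight H').append (q.whiskerLeft K)).Equiv
      ((q.whiskerLeft H).append (p.whiskerRight K')) := by
  refine equiv_of_chanAt fun s => ?_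
  simp only [chanAt_append, chanAt_whiskerLeft, chanAt_whiskerRight,
    Channel.margLeft_out_lTensor, Channel.margRight_out_rTensor, Channel.rTensor_comp_lTensor]

lemma ofUnitary_append (u : Unitary H K) (v : Unitary K L) :
    ((ofUnitary u).append (ofUnitary v)).Equiv (ofUnitary (u.trans v)) := by
  refine equiv_of_chanAt fun s => ?_
  simp only [chanAt_append, chanAt_ofUnitary, Channel.ofUnitary_trans]

lemma ofUnitary_refl : (ofUnitary (LinearIsometryEquiv.refl ℂ H)).Equiv (nil H) :=
  equiv_of_chanAt fun s => chanAt_ofUnitary _ s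

lemma whiskerLeft_ofUnitary (L : FdHilb) (u : Unitary H K) : ((ofUnitary u).whiskerLeft L).Equiv
    (ofUnitary (tensorU (LinearIsometryEquiv.refl ℂ L) u)) := by
  refine equiv_of_chanAt fun s => ?_
  simp only [chanAt_whiskerLeft, chanAt_ofUnitary, Channel.lTensor_ofUnitary]

lemma whiskerRight_ofUnitary (L : FdHilb) (u : Unitary H K) :
    ((ofUnitary u).whiskerRight L).Equiv
      (ofUnitary (tensorU u (LinearIsometryEquiv.refl ℂ L))) := by
  refine equiv_of_chanAt fun s => ?_
  simp only [chanAt_whiskerRight, chanAt_ofUnitary, Channel.rTensor_ofUnitary]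

lemma whiskerRight_whiskerRight_assoc (p : Proc H H') (K L : FdHilb) :
    (((p.whiskerRight K).whiskerRight L).append (ofUnitary (assocU H' K L))).Equiv
      ((ofUnitary (assocU H K L)).append (p.whiskerRight (K ⊠ L))) := by
  refine equiv_of_chanAt fun s => ?_
  simp only [chanAt_append, chanAt_whiskerRight, chanAt_ofUnitary, Channel.out_ofUnitary,
    QState.margLeft_conj_assocU, Channel.rTensor_rTensor_assoc]

lemma whiskerLeft_whiskerRight_assoc (p : Proc K K') (H L : FdHilb) :
    (((p.whiskerLeft H).whiskerRight L).append (ofUnitary (assocU H K' L))).Equiv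
      ((ofUnitary (assocU H K L)).append ((p.whiskerRight L).whiskerLeft H)) := by
  refine equiv_of_chanAt fun s => ?_
  simp only [chanAt_append, chanAt_whiskerRight, chanAt_whiskerLeft, chanAt_ofUnitary,
    Channel.out_ofUnitary, QState.margLeft_margRight_conj_assocU, Channel.rTensor_lTensor_assoc]

lemma whiskerLeft_whiskerLeft_assoc (p : Proc L H') (H K : FdHilb) :
    ((p.whiskerLeft (H ⊠ K)).append (ofUnitary (assocU H K H'))).Equiv
      ((ofUnitary (assocU H K L)).append ((p.whiskerLeft K).whiskerLeft H)) := by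
  refine equiv_of_chanAt fun s => ?_
  simp only [chanAt_append, chanAt_whiskerLeft, chanAt_ofUnitary,
    Channel.out_ofUnitary, QState.margRight_margRight_conj_assocU, Channel.lTensor_lTensor_assoc]

lemma whiskerLeft_lidU (p : Proc H K) :
    ((p.whiskerLeft FdHilb.unit).append (ofUnitary (lidU K))).Equiv
      ((ofUnitary (lidU H)).append p) := by
  refine equiv_of_chanAt fun s => ?_
  simp only [chanAt_append, chanAt_whiskerLeft, chanAt_ofUnitary, Channel.out_ofUnitary,
    QState.margRight_eq_conj_lidU, Channel.lTensor_lidU]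

lemma whiskerRight_ridU (p : Proc H K) :
    ((p.whiskerRight FdHilb.unit).append (ofUnitary (ridU K))).Equiv
      ((ofUnitary (ridU H)).append p) := by
  refine equiv_of_chanAt fun s => ?_
  simp only [chanAt_append, chanAt_whiskerRight, chanAt_ofUnitary, Channel.out_ofUnitary,
    QState.margLeft_eq_conj_ridU, Channel.rTensor_ridU]

lemma whiskerRight_swapU (p : Proc H K) (L : FdHilb) :
    ((p.whiskerRight L).append (ofUnitary (swapU K L))).Equiv
      ((ofUnitary (swapU H L)).append (p.whiskerLeft L)) := by
  refine equiv_of_chanAt fun s => ?_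
  simp only [chanAt_append, chanAt_whiskerRight, chanAt_whiskerLeft, chanAt_ofUnitary,
    Channel.out_ofUnitary, QState.margRight_conj_swapU, Channel.rTensor_swapU]

lemma whiskerLeft_swapU (p : Proc H K) (L : FdHilb) :
    ((p.whiskerLeft L).append (ofUnitary (swapU L K))).Equiv
      ((ofUnitary (swapU L H)).append (p.whiskerRight L)) := by
  refine equiv_of_chanAt fun s => ?_
  simp only [chanAt_append, chanAt_whiskerRight, chanAt_whiskerLeft, chanAt_ofUnitary,
    Channel.out_ofUnitary, QState.margLeft_conj_swapU, Channel.lTensor_swapU]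

end Proc

/-! ## Coherence for unitaries -/

namespace FdHilb

lemma unitary_ext {H K : FdHilb} {u v : Unitary H K}
    (h : u.toLinearEquiv.toLinearMap = v.toLinearEquiv.toLinearMap) : u = v :=
  LinearIsometryEquiv.ext fun x => LinearMap.congr_fun h x

lemma tensorU_refl_refl (H K : FdHilb) :
    tensorU (LinearIsometryEquiv.refl ℂ H) (LinearIsometryEquiv.refl ℂ K) =
      LinearIsometryEquiv.refl ℂ (H ⊠ K : FdHilb) :=
  unitary_ext (TensorProduct.ext' fun _ _ => rfl)

lemma tensorU_trans {H K L H' K' L' : FdHilb} (u : Unitary H K) (v : Unitary K L)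
    (u' : Unitary H' K') (v' : Unitary K' L') :
    (tensorU u u').trans (tensorU v v') = tensorU (u.trans v) (u'.trans v') :=
  unitary_ext (TensorProduct.ext' fun _ _ => rfl)

lemma assocU_pentagon (H K L M : FdHilb) :
    (tensorU (assocU H K L) (LinearIsometryEquiv.refl ℂ M)).trans
      ((assocU H (K ⊠ L) M).trans (tensorU (LinearIsometryEquiv.refl ℂ H) (assocU K L M))) =
        (assocU (H ⊠ K) L M).trans (assocU H K (L ⊠ M)) :=
  unitary_ext (TensorProduct.ext_fourfold fun _ _ _ _ => rfl)

/-- On pure tensors this is the balancing relation that moves the scalar across the tensor sign. -/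
lemma assocU_triangle (H K : FdHilb) :
    (assocU H unit K).trans (tensorU (LinearIsometryEquiv.refl ℂ H) (lidU K)) =
      tensorU (ridU H) (LinearIsometryEquiv.refl ℂ K) :=
  have h : ∀ (x : H) (c : ℂ) (y : K), x ⊗ₜ[ℂ] (c • y) = (c • x) ⊗ₜ[ℂ] y :=
    fun x c y => (TensorProduct.smul_tmul c x y).symm
  unitary_ext (TensorProduct.ext_threefold h)

lemma swapU_hexagon (H K L : FdHilb) :
    (assocU H K L).trans ((swapU H (K ⊠ L)).trans (assocU K L H)) =
      (tensorU (swapU H K) (LinearIsometryEquiv.refl ℂ L)).trans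
        ((assocU K H L).trans (tensorU (LinearIsometryEquiv.refl ℂ K) (swapU H L))) :=
  unitary_ext (TensorProduct.ext_threefold fun _ _ _ => rfl)

lemma swapU_hexagon' (H K L : FdHilb) :
    (assocU H K L).symm.trans ((swapU (H ⊠ K) L).trans (assocU L H K).symm) =
      (tensorU (LinearIsometryEquiv.refl ℂ H) (swapU K L)).trans
        ((assocU H L K).symm.trans (tensorU (swapU H L) (LinearIsometryEquiv.refl ℂ K))) :=
  unitary_ext (TensorProduct.ext_threefold' fun _ _ _ => rfl)

end FdHilb

/-! ## The symmetric monoidal category `DMix` -/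

namespace DMix

variable {H K L H' K' L' : DMix}

/-- The morphism inherited from quantum theory through a unitary. -/
def ofU {H K : FdHilb} (u : Unitary H K) : (show DMix from H) ⟶ (show DMix from K) :=
  (isoOfUnitary u).hom

lemma ofU_comp {H K L : FdHilb} (u : Unitary H K) (v : Unitary K L) :
    ofU u ≫ ofU v = ofU (u.trans v) :=
  Quotient.sound (Proc.ofUnitary_append u v)

lemma ofU_refl (H : FdHilb) : ofU (LinearIsometryEquiv.refl ℂ H) = 𝟙 (show DMix from H) :=
  Quotient.sound Proc.ofUnitary_refl

/-- The morphism `id_L ⊗ f`. -/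
def whiskerL (L : DMix) (f : H ⟶ K) : tensorObj L H ⟶ tensorObj L K :=
  Quotient.map (Proc.whiskerLeft L) (fun _ _ => Proc.whiskerLeft_congr L) f

/-- The morphism `f ⊗ id_L`. -/
def whiskerR (f : H ⟶ K) (L : DMix) : tensorObj H L ⟶ tensorObj K L :=
  Quotient.map (fun p => Proc.whiskerRight p L) (fun _ _ => Proc.whiskerRight_congr L) f

/-- The tensor product of morphisms. -/
def tensorOp : TensorOp := fun _ K H' _ f g => whiskerR f H' ≫ whiskerL K g

lemma whiskerL_id (L H : DMix) : whiskerL L (𝟙 H) = 𝟙 (tensorObj L H) := rfl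

lemma whiskerL_comp (M : DMix) (f : H ⟶ K) (g : K ⟶ L) :
    whiskerL M (f ≫ g) = whiskerL M f ≫ whiskerL M g := by
  induction f using Quotient.inductionOn with | _ p
  induction g using Quotient.inductionOn with | _ q
  exact congrArg _ (Proc.whiskerLeft_append M p q)

lemma whiskerR_comp (M : DMix) (f : H ⟶ K) (g : K ⟶ L) :
    whiskerR (f ≫ g) M = whiskerR f M ≫ whiskerR g M := by
  induction f using Quotient.inductionOn with | _ p
  induction g using Quotient.inductionOn with | _ q
  exact congrArg _ (Proc.whiskerRight_append M p q)

lemma whisker_exchange (f : H ⟶ K) (g : H' ⟶ K') :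
    whiskerR f H' ≫ whiskerL K g = whiskerL H g ≫ whiskerR f K' := by
  induction f using Quotient.inductionOn with | _ p
  induction g using Quotient.inductionOn with | _ q
  exact Quotient.sound (Proc.whisker_exchange p q)

lemma whiskerL_ofU (L : FdHilb) {H K : FdHilb} (u : Unitary H K) :
    whiskerL L (ofU u) = ofU (tensorU (LinearIsometryEquiv.refl ℂ L) u) :=
  Quotient.sound (Proc.whiskerLeft_ofUnitary L u)

lemma whiskerR_ofU (L : FdHilb) {H K : FdHilb} (u : Unitary H K) :
    whiskerR (ofU u) L = ofU (tensorU u (LinearIsometryEquiv.refl ℂ L)) :=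
  Quotient.sound (Proc.whiskerRight_ofUnitary L u)

lemma tensorOp_id_left (L : DMix) (f : H ⟶ K) : tensorOp (𝟙 L) f = whiskerL L f :=
  Category.id_comp _

lemma tensorOp_id_right (L : DMix) (f : H ⟶ K) : tensorOp f (𝟙 L) = whiskerR f L :=
  Category.comp_id _

lemma tensorOp_ofU {H K H' K' : FdHilb} (u : Unitary H K) (v : Unitary H' K') :
    tensorOp (ofU u) (ofU v) = ofU (tensorU u v) := by
  rw [tensorOp, whiskerR_ofU, whiskerL_ofU, ofU_comp, tensorU_trans]
  rfl

lemma whiskerR_whiskerR_assoc (f : H ⟶ H') (K L : DMix) :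
    whiskerR (whiskerR f K) L ≫ ofU (assocU H' K L) =
      ofU (assocU H K L) ≫ whiskerR f (tensorObj K L) := by
  induction f using Quotient.inductionOn with | _ p
  exact Quotient.sound (Proc.whiskerRight_whiskerRight_assoc p K L)

lemma whiskerL_whiskerR_assoc (f : K ⟶ K') (H L : DMix) :
    whiskerR (whiskerL H f) L ≫ ofU (assocU H K' L) =
      ofU (assocU H K L) ≫ whiskerL H (whiskerR f L) := by
  induction f using Quotient.inductionOn with | _ p
  exact Quotient.sound (Proc.whiskerLeft_whiskerRight_assoc p H L)

lemma whiskerL_whiskerL_assoc (f : L ⟶ L') (H K : DMix) :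
    whiskerL (tensorObj H K) f ≫ ofU (assocU H K L') =
      ofU (assocU H K L) ≫ whiskerL H (whiskerL K f) := by
  induction f using Quotient.inductionOn with | _ p
  exact Quotient.sound (Proc.whiskerLeft_whiskerLeft_assoc p H K)

lemma whiskerL_lidU (f : H ⟶ K) : whiskerL FdHilb.unit f ≫ ofU (lidU K) = ofU (lidU H) ≫ f := by
  induction f using Quotient.inductionOn with | _ p
  exact Quotient.sound (Proc.whiskerLeft_lidU p)

lemma whiskerR_ridU (f : H ⟶ K) : whiskerR f FdHilb.unit ≫ ofU (ridU K) = ofU (ridU H) ≫ f := by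
  induction f using Quotient.inductionOn with | _ p
  exact Quotient.sound (Proc.whiskerRight_ridU p)

lemma whiskerR_swapU (f : H ⟶ K) (L : DMix) :
    whiskerR f L ≫ ofU (swapU K L) = ofU (swapU H L) ≫ whiskerL L f := by
  induction f using Quotient.inductionOn with | _ p
  exact Quotient.sound (Proc.whiskerRight_swapU p L)

lemma whiskerL_swapU (f : H ⟶ K) (L : DMix) :
    whiskerL L f ≫ ofU (swapU L K) = ofU (swapU L H) ≫ whiskerR f L := by
  induction f using Quotient.inductionOn with | _ p
  exact Quotient.sound (Proc.whiskerLeft_swapU p L)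

/-- The interchange law, obtained by moving the first right-hand morphism past the second left-hand
one. -/
lemma tensorOp_comp (f : H ⟶ K) (f' : H' ⟶ K') (g : K ⟶ L) (g' : K' ⟶ L') :
    tensorOp f f' ≫ tensorOp g g' = tensorOp (f ≫ g) (f' ≫ g') := by
  simp only [tensorOp, whiskerL_comp, whiskerR_comp, Category.assoc]
  rw [← Category.assoc (whiskerL K f'), ← whisker_exchange, Category.assoc]

/-- `DMix` is a monoidal category. -/
abbrev monoidal : MonoidalCategory DMix where
  toMonoidalCategoryStruct := monoidalData tensorOp
  tensorHom_def f g := by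
    change _ = tensorOp f (𝟙 _) ≫ tensorOp (𝟙 _) g
    rw [tensorOp_id_left, tensorOp_id_right]; rfl
  id_tensorHom_id H K := tensorOp_id_left H (𝟙 K)
  tensorHom_comp_tensorHom f f' g g' := tensorOp_comp f f' g g'
  whiskerLeft_id H K := tensorOp_id_left H (𝟙 K)
  id_whiskerRight H K := tensorOp_id_right K (𝟙 H)
  associator_naturality {H K L H' K' L'} f g h := by
    change tensorOp (tensorOp f g) h ≫ ofU (assocU H' K' L') =
      ofU (assocU H K L) ≫ tensorOp f (tensorOp g h)
    simp only [tensorOp, whiskerL_comp, whiskerR_comp, Category.assoc]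
    -- The three whiskered morphisms are carried through the associator one at a time, the last one
    -- first.
    rw [whiskerL_whiskerL_assoc, ← Category.assoc (whiskerR (whiskerL _ g) _),
      whiskerL_whiskerR_assoc, Category.assoc, ← Category.assoc, whiskerR_whiskerR_assoc,
      Category.assoc]
  leftUnitor_naturality {H K} f := by
    change tensorOp (𝟙 _) f ≫ ofU (lidU K) = ofU (lidU H) ≫ f
    rw [tensorOp_id_left, whiskerL_lidU]
  rightUnitor_naturality {H K} f := by
    change tensorOp f (𝟙 _) ≫ ofU (ridU K) = ofU (ridU H) ≫ f
    rw [tensorOp_id_right, whiskerR_ridU]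
  pentagon H K L M := by
    change tensorOp (ofU (assocU H K L)) (𝟙 M) ≫ ofU (assocU H (K ⊠ L) M) ≫
      tensorOp (𝟙 H) (ofU (assocU K L M)) = ofU (assocU (H ⊠ K) L M) ≫ ofU (assocU H K (L ⊠ M))
    rw [tensorOp_id_left, tensorOp_id_right, whiskerL_ofU, whiskerR_ofU, ofU_comp, ofU_comp,
      ofU_comp, assocU_pentagon]
  triangle H K := by
    change ofU (assocU H FdHilb.unit K) ≫ tensorOp (𝟙 H) (ofU (lidU K)) =
      tensorOp (ofU (ridU H)) (𝟙 K)
    rw [tensorOp_id_left, tensorOp_id_right, whiskerL_ofU, whiskerR_ofU, ofU_comp,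
      assocU_triangle]

/-- `DMix` is a symmetric monoidal category. -/
abbrev symmetric : @SymmetricCategory DMix _ monoidal :=
  letI := monoidal
  { braiding := fun H K => isoOfUnitary (swapU H K)
    braiding_naturality_right := fun L {H K} f => by
      change tensorOp (𝟙 L) f ≫ ofU (swapU L K) = ofU (swapU L H) ≫ tensorOp f (𝟙 L)
      rw [tensorOp_id_left, tensorOp_id_right, whiskerL_swapU]
    braiding_naturality_left := fun {H K} f L => by
      change tensorOp f (𝟙 L) ≫ ofU (swapU K L) = ofU (swapU H L) ≫ tensorOp (𝟙 L) f
      rw [tensorOp_id_left, tensorOp_id_right, whiskerR_swapU]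
    hexagon_forward := fun H K L => by
      change ofU (assocU H K L) ≫ ofU (swapU H (K ⊠ L)) ≫ ofU (assocU K L H) =
        tensorOp (ofU (swapU H K)) (𝟙 L) ≫ ofU (assocU K H L) ≫ tensorOp (𝟙 K) (ofU (swapU H L))
      rw [tensorOp_id_left, tensorOp_id_right, whiskerL_ofU, whiskerR_ofU, ofU_comp, ofU_comp,
        ofU_comp, ofU_comp, swapU_hexagon]
    hexagon_reverse := fun H K L => by
      change ofU (assocU H K L).symm ≫ ofU (swapU (H ⊠ K) L) ≫ ofU (assocU L H K).symm =
        tensorOp (𝟙 H) (ofU (swapU K L)) ≫ ofU (assocU H L K).symm ≫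
          tensorOp (ofU (swapU H L)) (𝟙 K)
      rw [tensorOp_id_left, tensorOp_id_right, whiskerL_ofU, whiskerR_ofU, ofU_comp, ofU_comp,
        ofU_comp, ofU_comp, swapU_hexagon']
    symmetry := fun H K => (isoOfUnitary (swapU H K)).hom_inv_id }

lemma isSymmetricMonoidal : IsSymmetricMonoidal (monoidalData tensorOp) swap :=
  ⟨monoidal, rfl, symmetric, fun _ _ => HEq.rfl⟩

end DMix

/-! ## Coherence for splittings of lists -/

namespace FdHilb

/-- The unitary given by an equality of Hilbert spaces. -/
def castU {H K : FdHilb} (h : H = K) : Unitary H K :=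
  h ▸ LinearIsometryEquiv.refl ℂ H

lemma castU_tensor (H : FdHilb) {K L : FdHilb} (h : K = L) (h' : (H ⊠ K) = H ⊠ L) :
    castU h' = tensorU (LinearIsometryEquiv.refl ℂ H) (castU h) := by
  subst h
  exact (tensorU_refl_refl H K).symm

lemma tensorU_lidU_symm_assocU (H K : FdHilb) :
    (tensorU (lidU H).symm (LinearIsometryEquiv.refl ℂ K)).trans (assocU unit H K) =
      (lidU (H ⊠ K)).symm :=
  unitary_ext (TensorProduct.ext' fun _ _ => rfl)

lemma assocU_symm_naturality {H K L H' K' L' : FdHilb} (u : Unitary H H') (v : Unitary K K')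
    (w : Unitary L L') : (assocU H K L).symm.trans (tensorU (tensorU u v) w) =
      (tensorU u (tensorU v w)).trans (assocU H' K' L').symm :=
  unitary_ext (TensorProduct.ext_threefold' fun _ _ _ => rfl)

/-- The pentagon solved for the form in which the recursive definition of `splitU` produces it. -/
lemma assocU_symm_pentagon (H K L M : FdHilb) :
    (assocU H (K ⊠ L) M).symm.trans
      ((tensorU (assocU H K L).symm (LinearIsometryEquiv.refl ℂ M)).trans
        (assocU (H ⊠ K) L M)) =
      (tensorU (LinearIsometryEquiv.refl ℂ H) (assocU K L M)).trans (assocU H K (L ⊠ M)).symm := by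
  refine LinearIsometryEquiv.ext fun x => ?_
  have h := congrArg (fun u => u.trans (assocU H K (L ⊠ M)).symm) (assocU_pentagon H K L M)
  obtain ⟨y, rfl⟩ := ((tensorU (assocU H K L) (LinearIsometryEquiv.refl ℂ M)).trans
    (assocU H (K ⊠ L) M)).surjective x
  have hy := congrArg (fun u : Unitary _ _ => u y) h
  have e : (tensorU (assocU H K L).symm (LinearIsometryEquiv.refl ℂ M))
      (tensorU (assocU H K L) (LinearIsometryEquiv.refl ℂ M) y) = y :=
    (tensorU (assocU H K L) (LinearIsometryEquiv.refl ℂ M)).symm_apply_apply y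
  simp only [LinearIsometryEquiv.trans_apply, LinearIsometryEquiv.symm_apply_apply] at hy ⊢
  rw [e, hy]

lemma assocU_symm_ridU (H K : FdHilb) : (assocU H K unit).symm.trans (ridU (H ⊠ K)) =
    tensorU (LinearIsometryEquiv.refl ℂ H) (ridU K) :=
  have h : ∀ (x : H) (y : K) (c : ℂ), c • x ⊗ₜ[ℂ] y = x ⊗ₜ[ℂ] (c • y) :=
    fun x y c => (TensorProduct.tmul_smul c x y).symm
  unitary_ext (TensorProduct.ext_threefold' h)

/-- Inductive step of `splitU_assoc`, with `h` as the induction hypothesis. Arbitrary spaces and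
unitaries replace the lists, so that only naturality and the pentagon are involved. -/
lemma splitting_assoc_step (H : FdHilb) {X Y Z A B M N : FdHilb} (t : Unitary X (Y ⊠ N))
    (s : Unitary Y (A ⊠ M)) (c : Unitary X Z) (t' : Unitary Z (A ⊠ B)) (r : Unitary B (M ⊠ N))
    (h : t.trans ((tensorU s (LinearIsometryEquiv.refl ℂ N)).trans (assocU A M N)) =
      c.trans (t'.trans (tensorU (LinearIsometryEquiv.refl ℂ A) r))) :
    ((tensorU (LinearIsometryEquiv.refl ℂ H) t).trans (assocU H Y N).symm).trans
      ((tensorU ((tensorU (LinearIsometryEquiv.refl ℂ H) s).trans (assocU H A M).symm)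
        (LinearIsometryEquiv.refl ℂ N)).trans (assocU (H ⊠ A) M N)) =
      (tensorU (LinearIsometryEquiv.refl ℂ H) c).trans
        (((tensorU (LinearIsometryEquiv.refl ℂ H) t').trans (assocU H A B).symm).trans
          (tensorU (LinearIsometryEquiv.refl ℂ (H ⊠ A : FdHilb)) r)) := by
  have comp₂ : ∀ {A B C : FdHilb} (u : Unitary A B) (v : Unitary B C),
      tensorU (LinearIsometryEquiv.refl ℂ H) (u.trans v) =
        (tensorU (LinearIsometryEquiv.refl ℂ H) u).trans
          (tensorU (LinearIsometryEquiv.refl ℂ H) v) := fun u v => by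
    rw [tensorU_trans, LinearIsometryEquiv.refl_trans]
  have h' := congrArg (tensorU (LinearIsometryEquiv.refl ℂ H)) h
  simp only [comp₂] at h'
  have e : tensorU ((tensorU (LinearIsometryEquiv.refl ℂ H) s).trans (assocU H A M).symm)
      (LinearIsometryEquiv.refl ℂ N) =
        (tensorU (tensorU (LinearIsometryEquiv.refl ℂ H) s) (LinearIsometryEquiv.refl ℂ N)).trans
          (tensorU (assocU H A M).symm (LinearIsometryEquiv.refl ℂ N)) := by
    rw [tensorU_trans, LinearIsometryEquiv.refl_trans]
  have n₁ := assocU_symm_naturality (LinearIsometryEquiv.refl ℂ H) s (LinearIsometryEquiv.refl ℂ N)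
  have n₂ := assocU_symm_naturality (LinearIsometryEquiv.refl ℂ H) (LinearIsometryEquiv.refl ℂ A) r
  have p := assocU_symm_pentagon H A M N
  rw [tensorU_refl_refl] at n₂
  rw [e]
  refine LinearIsometryEquiv.ext fun x => ?_
  have hx := DFunLike.congr_fun h' x
  have n₁x := fun y => DFunLike.congr_fun n₁ y
  have n₂x := fun y => DFunLike.congr_fun n₂ y
  have px := fun y => DFunLike.congr_fun p y
  simp only [LinearIsometryEquiv.trans_apply] at hx n₁x n₂x px ⊢
  rw [n₁x, px, hx, n₂x]

lemma splitting_unit_step (H : FdHilb) {X A : FdHilb} (t : Unitary X (A ⊠ unit)) :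
    ((tensorU (LinearIsometryEquiv.refl ℂ H) t).trans (assocU H A unit).symm).trans
      (ridU (H ⊠ A)) = tensorU (LinearIsometryEquiv.refl ℂ H) (t.trans (ridU A)) := by
  rw [← LinearIsometryEquiv.trans_assoc, assocU_symm_ridU, tensorU_trans]
  rfl

lemma lidU_symm_ridU : (lidU unit).symm.trans (ridU unit) = LinearIsometryEquiv.refl ℂ unit :=
  unitary_ext (LinearMap.ext_ring (mul_one (1 : ℂ)))

end FdHilb

namespace StrictDMix

/-- Both ways of splitting a triple concatenation agree up to the cast between the two bracketings,
which are equal as lists but not by computation. The cast passes through the head factor by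
`castU_tensor`. -/
lemma splitU_assoc (l m n : List FdHilb) (h : space (l ++ m ++ n) = space (l ++ (m ++ n))) :
    (splitU (l ++ m) n).trans
      ((tensorU (splitU l m) (LinearIsometryEquiv.refl ℂ (space n))).trans
        (assocU (space l) (space m) (space n))) =
      (castU h).trans ((splitU l (m ++ n)).trans
        (tensorU (LinearIsometryEquiv.refl ℂ (space l)) (splitU m n))) := by
  induction l with
  | nil =>
    change (splitU m n).trans ((tensorU (lidU (space m)).symm _).trans (assocU unit _ _)) = _
    rw [tensorU_lidU_symm_assocU]
    have hc : castU h = LinearIsometryEquiv.refl ℂ (space (m ++ n)) := rfl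
    rw [hc]
    exact LinearIsometryEquiv.ext fun x => rfl
  | cons H l ih =>
    have h' : space (l ++ m ++ n) = space (l ++ (m ++ n)) :=
      congrArg space (List.append_assoc l m n)
    have hc : castU h = tensorU (LinearIsometryEquiv.refl ℂ H) (castU h') := castU_tensor H h' h
    rw [hc]
    exact splitting_assoc_step H _ _ _ _ _ (ih h')

lemma splitU_ridU (l : List FdHilb) (h : space (l ++ []) = space l) :
    (splitU l []).trans (ridU (space l)) = castU h := by
  induction l with
  | nil => exact lidU_symm_ridU
  | cons H l ih =>
    have h' : space (l ++ []) = space l := congrArg space (List.append_nil l)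
    have hc : castU h = tensorU (LinearIsometryEquiv.refl ℂ H) (castU h') := castU_tensor H h' h
    rw [hc, ← ih h']
    exact splitting_unit_step H _

end StrictDMix

/-! ## The strict symmetric monoidal category -/

lemma DMix.eqToHom_eq_ofU {H K : FdHilb} (h : H = K) :
    eqToHom (C := DMix) h = DMix.ofU (castU h) := by
  subst h
  exact (DMix.ofU_refl H).symm

namespace StrictDMix

open DMix (tensorOp ofU)

attribute [local instance] DMix.monoidal DMix.symmetric

/-- The functor which forgets the decomposition into tensor factors. -/
def forget : StrictDMix ⥤ DMix where
  obj l := l.toDMix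
  map f := f

instance : forget.Faithful where
  map_injective h := h

instance monoidalStruct : MonoidalCategoryStruct StrictDMix := monoidalData tensorOp

/-- `splitU_assoc` with the splittings moved to one side, as required for inducing the associator.
-/
lemma splitU_assoc_ofU (l m n : List FdHilb)
    (h : space (l ++ m ++ n) = space (l ++ (m ++ n))) :
    ofU (castU h) = (ofU (splitU (l ++ m) n) ≫
      tensorOp (ofU (splitU l m)) (𝟙 (space n : DMix))) ≫ ofU (assocU _ _ _) ≫
        tensorOp (𝟙 (space l : DMix)) (ofU (splitU m n).symm) ≫ ofU (splitU l (m ++ n)).symm := by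
  rw [← DMix.ofU_refl, ← DMix.ofU_refl, DMix.tensorOp_ofU, DMix.tensorOp_ofU, DMix.ofU_comp,
    DMix.ofU_comp, DMix.ofU_comp, DMix.ofU_comp]
  congr 1
  have e := congrArg (fun u => u.trans
    ((tensorU (LinearIsometryEquiv.refl ℂ (space l)) (splitU m n).symm).trans
      (splitU l (m ++ n)).symm)) (splitU_assoc l m n h)
  refine Eq.trans ?_ e.symm
  refine LinearIsometryEquiv.ext fun x => ?_
  have e2 : ∀ y, (tensorU (LinearIsometryEquiv.refl ℂ (space l)) (splitU m n).symm)
      (tensorU (LinearIsometryEquiv.refl ℂ (space l)) (splitU m n) y) = y := fun y =>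
    (tensorU (LinearIsometryEquiv.refl ℂ (space l)) (splitU m n)).symm_apply_apply y
  simp only [LinearIsometryEquiv.trans_apply, e2, LinearIsometryEquiv.symm_apply_apply]

/-- The monoidal structure of `StrictDMix` is induced from the one of `DMix`. -/
def inducingData : Monoidal.InducingFunctorData forget where
  μIso l m := (split l m).symm
  whiskerLeft_eq _ _ _ _ := rfl
  whiskerRight_eq _ _ := rfl
  tensorHom_eq _ _ := rfl
  εIso := Iso.refl _
  associator_eq l m n := by
    have h := congrArg toDMix (tensor_assoc l m n)
    -- The associator is an equality isomorphism, so its image in `DMix` is one too, and hence comes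
    -- from a cast unitary.
    refine (eqToHom_map forget (tensor_assoc l m n)).trans ?_
    refine (DMix.eqToHom_eq_ofU h).trans ?_
    exact splitU_assoc_ofU l m n h
  leftUnitor_eq l := by
    -- Here `[] ++ l` computes to `l`, so no cast appears, and the splitting itself is the inverse
    -- unitor.
    change 𝟙 _ = (ofU (lidU (space l)).symm ≫ tensorOp (𝟙 _) (𝟙 _)) ≫ ofU (lidU (space l))
    rw [DMix.tensorOp_id_left, DMix.whiskerL_id, Category.comp_id]
    exact (DMix.isoOfUnitary (lidU (space l))).inv_hom_id.symm
  rightUnitor_eq l := by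
    have h := congrArg toDMix (tensor_unit l)
    refine (eqToHom_map forget (tensor_unit l)).trans ?_
    refine (DMix.eqToHom_eq_ofU h).trans ?_
    change _ = (ofU (splitU l []) ≫ tensorOp (𝟙 _) (𝟙 _)) ≫ ofU (ridU (space l))
    rw [DMix.tensorOp_id_left, DMix.whiskerL_id, Category.comp_id]
    exact (congrArg ofU (splitU_ridU l h).symm).trans (DMix.ofU_comp _ _).symm

/-- `StrictDMix` is a monoidal category. -/
abbrev monoidal : MonoidalCategory StrictDMix := Monoidal.induced forget inducingData

/-- The symmetry of `StrictDMix`. -/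
def braidingIso (l m : StrictDMix) : tensorObj l m ≅ tensorObj m l where
  hom := swap l m
  inv := swap m l
  hom_inv_id := forget.map_injective
    ((split l m).trans ((DMix.isoOfUnitary (swapU l.toDMix m.toDMix)).trans
      (split m l).symm)).hom_inv_id
  inv_hom_id := forget.map_injective
    ((split l m).trans ((DMix.isoOfUnitary (swapU l.toDMix m.toDMix)).trans
      (split m l).symm)).inv_hom_id

attribute [local instance] monoidal

/-- `StrictDMix` is a braided monoidal category. -/
abbrev braided : BraidedCategory StrictDMix :=
  letI : forget.Monoidal := Monoidal.fromInducedMonoidal forget inducingData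
  -- By faithfulness only compatibility of the symmetry with the splittings is needed, and the
  -- symmetry was defined by transport along them.
  BraidedCategory.ofFaithful forget braidingIso fun l m => by
    change (split l m).inv ≫ (split l m).hom ≫ DMix.swap _ _ ≫ (split m l).inv =
      DMix.swap _ _ ≫ (split m l).inv
    rw [Iso.inv_hom_id_assoc]

/-- `StrictDMix` is a symmetric monoidal category. -/
abbrev symmetric : SymmetricCategory StrictDMix where
  toBraidedCategory := braided
  symmetry l m := (braidingIso l m).hom_inv_id

lemma isSymmetricMonoidal : IsSymmetricMonoidal (monoidalData tensorOp) swap :=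
  ⟨monoidal, rfl, symmetric, fun _ _ => HEq.rfl⟩

lemma isStrict (T : DMix.TensorOp) : IsStrict (monoidalData T) :=
  ⟨fun l m n => ⟨tensor_assoc l m n, rfl⟩, fun l => ⟨unit_tensor l, rfl⟩,
    fun l => ⟨tensor_unit l, rfl⟩⟩

end StrictDMix

end

theorem mainTheorem3 :
    -- Deutsch's prescription determines a state on the closed timelike curve,
    (∀ (H K : FdHilb) (b : Box H K) (E : FdHilb) (ρ : QState (FdHilb.tensor E H)),
      ∃! τ : QState b.ctc, b.IsDeutschState ρ τ) ∧
    -- so that a sequence of boxes acts as a function on states;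
    (∀ (H K : FdHilb) (p : Proc H K) (E : FdHilb) (ρ : QState (FdHilb.tensor E H)),
      ∃! σ : QState (FdHilb.tensor E K), p.Acts E ρ σ) ∧
    -- the tensor product of sequences is well defined on morphisms,
    ∃ T : DMix.TensorOp,
      (∀ (H K H' K' : FdHilb) (p : Proc H K) (q : Proc H' K'),
        T (H := H) (K := K) (H' := H') (K' := K') ⟦p⟧ ⟦q⟧ = ⟦p.tensor q⟧) ∧
      -- it makes `DMix` a symmetric monoidal category,
      IsSymmetricMonoidal (DMix.monoidalData T) DMix.swap ∧
      -- and a strict one when tensor products of Hilbert spaces are written without brackets.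
      IsStrict (StrictDMix.monoidalData T) ∧
      IsSymmetricMonoidal (StrictDMix.monoidalData T) StrictDMix.swap := by
  refine ⟨fun H K b E ρ => ⟨_, (b.isDeutschState_iff ρ _).2 rfl,
      fun τ h => (b.isDeutschState_iff ρ τ).1 h⟩,
    fun H K p E ρ => ⟨_, (p.acts_iff ρ _).2 rfl, fun σ h => (p.acts_iff ρ σ).1 h⟩,
    -- Whiskering is defined on representatives, so on classes of sequences the formula holds by
    -- computation.
    DMix.tensorOp, fun _ _ _ _ _ _ => rfl, DMix.isSymmetricMonoidal,
    StrictDMix.isStrict _, StrictDMix.isSymmetricMonoidal⟩
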